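/- Let $m,n,d,e,k$ be positive integers with $m=2n$, $e=\gcd(n,d)=\gcd(m,d)$ and $1\le k\le n/e$. Let $s=(s(i))_{i\in\mathbb Z/(2^m-1)}$ be a binary maximum-length sequence of length $2^m-1$, i.e. a nonzero binary sequence that satisfies a linear recurrence of order $m$ over $\mathbb F_2$ and has least period $2^m-1$. For $0\le j<k$ let $s_j$ be the circular decimation $s_j(i)=s\big((2^{(n/e-j)d}+1)\,i\big)$, and assume that $s_0$ is not identically zero. Let $C$ (the Kasami type code of relative dimension $2k+1$) be the $\mathbb F_2$-vector space spanned by all circular shifts of $s,s_0,s_1,\dots,s_{k-1}$. For $c\in C$ put $\mathrm{DC}(c)=\sum_{i=0}^{2^m-2}(-1)^{c_i}$. Then for every $j=0,1,\dots,k-1$ and every $\varepsilon\in\{1,-1\}$, $$\#\{0\ne c\in C:\ \mathrm{DC}(c)=-1+\varepsilon 2^{m/2+ej}\}=\frac12\big(2^{m-2ej}+\varepsilon 2^{m/2-ej}\big)\sum_{v=j}^{k-1}(-1)^{v-j}4^{e\binom{v-j}{2}}\binom{v}{j}_{4^e}\binom{m/(2e)}{v}_{4^e}\big(2^{n(2k-1-2v)+ev}-1\big),$$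 where $\binom{a}{b}_q=\prod_{i=0}^{b-1}\frac{q^{a-i}-1}{q^{i+1}-1}$ is the Gaussian binomial coefficient. -/

import Mathlib

/-- A binary sequence of period dividing `N`, that is, a binary word of length `N` whose
positions are read modulo `N`. -/
abbrev BinSeq (N : ℕ) : Type := ZMod N → ZMod 2

namespace BinSeq

/-- The circular shift of `s` by `t`. -/
def shift {N : ℕ} (t : ZMod N) (s : BinSeq N) : BinSeq N := fun i => s (i + t)

/-- The circular decimation of `s` with decimation factor `f`. -/
def decimate {N : ℕ} (f : ℕ) (s : BinSeq N) : BinSeq N := fun i => s ((f : ZMod N) * i)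

/-- Maximum-length sequences (m-sequences) of length `2 ^ m - 1`: nonzero sequences satisfying a
linear recurrence of order `m` over `𝔽₂` and having least period exactly `2 ^ m - 1`. -/
def IsMaximumLength (m : ℕ) (s : BinSeq (2 ^ m - 1)) : Prop :=
  s ≠ 0 ∧
  (∃ a : Fin m → ZMod 2, ∀ i : ZMod (2 ^ m - 1),
    s (i + (m : ZMod (2 ^ m - 1))) = ∑ l : Fin m, a l * s (i + ((l : ℕ) : ZMod (2 ^ m - 1)))) ∧
  ∀ t : ZMod (2 ^ m - 1), shift t s = s → t = 0

/-- The DC component `∑_{i=0}^{N-1} (-1)^{c_i}` of a word of length `N`. -/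
def dc {N : ℕ} (c : BinSeq N) : ℤ :=
  ∑ i ∈ Finset.range N, (-1 : ℤ) ^ (c (i : ZMod N)).val

/-- The sequence `s_j`: the circular decimation of `s` with factor `2 ^ ((n / e - j) d) + 1`. -/
def kasamiDecimation {N : ℕ} (n d e : ℕ) (s : BinSeq N) (j : ℕ) : BinSeq N :=
  decimate (2 ^ ((n / e - j) * d) + 1) s

/-- The Kasami type code: the `𝔽₂`-vector space spanned by all circular shifts of
`s, s_0, …, s_{k-1}`. -/
def kasamiCode {N : ℕ} (n d e k : ℕ) (s : BinSeq N) : Submodule (ZMod 2) (BinSeq N) :=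
  Submodule.span (ZMod 2)
    {c | ∃ t : ZMod N, c = shift t s ∨ ∃ j < k, c = shift t (kasamiDecimation n d e s j)}

end BinSeq

/-- The Gaussian binomial coefficient, `∏_{i<b} (q^{a-i} - 1) / (q^{i+1} - 1)`. -/
def gaussianBinomial (q : ℚ) (a b : ℕ) : ℚ :=
  ∏ i ∈ Finset.range b, (q ^ (a - i) - 1) / (q ^ (i + 1) - 1)

/-! The Kasami type code consists of the words `(Tr (b x) + Q x)_x`, `x` running through the nonzero
elements of the field `F` with `2 ^ m` elements, where `Q` belongs to a linear family of quadratic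
forms. Put `q = 2 ^ e` and `N = n / e`, let `σ` be the `d`-th power of the Frobenius and `K`, with `q`
elements, its fixed field, so that `[F : K] = 2 N`. The condition on the greatest common divisors
makes `σ ^ N` the involution of `F`, and the decimations of `s` contribute the forms
`Q x = ∑ j < k, Tr (β j * (x * σ ^ (N - j) x))`.

The DC component of a word is a Walsh coefficient of `Q`, less one. The moments of order one and two
show that the values `± 2 ^ (n + e j)` are taken, for a fixed `Q`, only if the radical of `Q` has
dimension `2 j` over `K`, and then a number of times that depends on `j` and the sign only
(`card_walsh_eq`). So the problem is to find the distribution of the dimensions of the radicals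
(`card_finrank_ker_eq`).

The polarization of `Q` is `(x, y) ↦ Tr (L x * y)` for a linearized polynomial `L` in `σ` with
exponents in an interval of length `2 (k - 1)` around `N`. A nonzero linearized polynomial of
`σ`-degree `r` has a kernel of dimension at most `r` (`finrank_ker_linearized_le`), so a radical has
dimension at most `2 (k - 1)` unless `L = 0`, and it is even-dimensional since the polarization is
alternating. The forms orthogonal to the family are those with no exponents in that interval, and the
same bound shows that a nonzero one has rank at least `2 k`, whereas a sum of `u` products `x ∧ z` has
rank at most `2 u`. Hence, by duality, the number of members of the family whose radical contains a
given subspace of dimension `u < k` is the same proportion as among all alternating forms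
(`card_formsAbove`). These numbers are the moments of the distribution; a recursion over subspaces
puts them in closed form (`sum_formsAbove_prod`), and Gaussian inversion solves for the distribution.

The trace representation of `s` comes from its annihilator in `𝔽₂[X]`, acting by shifts. The shifts of
`s` and zero make up all `2 ^ m` sequences that polynomials can produce from `s`, so the quotient by
the annihilator is a field in which `X` generates the multiplicative group
(`BinSeq.IsMaximumLength.exists_trace_representation`). -/

open Module

/-! ### Gaussian binomial coefficients -/

namespace gaussianBinomial

variable {q : ℚ}

@[simp] lemma zero_right (a : ℕ) : gaussianBinomial q a 0 = 1 := by simp [gaussianBinomial]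

lemma eq_zero_of_lt {a b : ℕ} (h : a < b) : gaussianBinomial q a b = 0 :=
  Finset.prod_eq_zero (Finset.mem_range.2 h) (by simp)

lemma pow_succ_sub_one_ne_zero (hq : 1 < q) (b : ℕ) : q ^ (b + 1) - 1 ≠ 0 :=
  sub_ne_zero.2 (one_lt_pow₀ hq (Nat.succ_ne_zero b)).ne'

lemma succ_right_mul (hq : 1 < q) (a b : ℕ) :
    gaussianBinomial q a (b + 1) * (q ^ (b + 1) - 1) =
      gaussianBinomial q a b * (q ^ (a - b) - 1) := by
  have h := pow_succ_sub_one_ne_zero hq b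
  rw [gaussianBinomial, Finset.prod_range_succ, ← gaussianBinomial]
  field_simp

lemma succ_succ_mul (hq : 1 < q) (a b : ℕ) :
    gaussianBinomial q (a + 1) (b + 1) * (q ^ (b + 1) - 1) =
      gaussianBinomial q a b * (q ^ (a + 1) - 1) := by
  have h := pow_succ_sub_one_ne_zero hq b
  simp only [gaussianBinomial, Finset.prod_div_distrib]
  rw [Finset.prod_range_succ', Finset.prod_range_succ (fun i => q ^ (i + 1) - 1)]
  have h' : ∏ i ∈ Finset.range b, (q ^ (i + 1) - 1) ≠ 0 :=
    Finset.prod_ne_zero_iff.2 fun i _ => pow_succ_sub_one_ne_zero hq i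
  simp only [Nat.add_sub_add_right, Nat.sub_zero]
  field_simp

lemma self (hq : 1 < q) (a : ℕ) : gaussianBinomial q a a = 1 := by
  induction a with
  | zero => simp
  | succ a ih =>
    have := succ_succ_mul hq a a
    rw [ih, one_mul] at this
    exact mul_right_cancel₀ (pow_succ_sub_one_ne_zero hq a) (by rw [this, one_mul])

/-- The `q`-analogue of Pascal's rule. -/
lemma succ_succ (hq : 1 < q) (a b : ℕ) :
    gaussianBinomial q (a + 1) (b + 1) =
      gaussianBinomial q a b + q ^ (b + 1) * gaussianBinomial q a (b + 1) := by
  refine mul_right_cancel₀ (pow_succ_sub_one_ne_zero hq b) ?_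
  rw [succ_succ_mul hq, add_mul, mul_assoc, succ_right_mul hq]
  rcases le_or_gt b a with h | h
  · obtain ⟨c, rfl⟩ := Nat.exists_eq_add_of_le h
    rw [Nat.add_sub_cancel_left]
    ring
  · simp [eq_zero_of_lt h]

/-- The alternating sums of the `q`-binomial theorem telescope by Pascal's rule. -/
lemma alternating_partial_sum (hq : 1 < q) (a t : ℕ) :
    ∑ w ∈ Finset.range (t + 1),
        (-1 : ℚ) ^ w * q ^ (w.choose 2) * gaussianBinomial q (a + 1) w =
      (-1) ^ t * q ^ ((t + 1).choose 2) * gaussianBinomial q a t := by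
  induction t with
  | zero => simp
  | succ t ih =>
    rw [Finset.sum_range_succ, ih, succ_succ hq, Nat.choose_succ_succ' (t + 1) 1,
      Nat.choose_one_right]
    ring

lemma mul_eq_mul (hq : 1 < q) {i j : ℕ} (w : ℕ) :
    gaussianBinomial q (j + w) j * gaussianBinomial q i (j + w) =
      gaussianBinomial q i j * gaussianBinomial q (i - j) w := by
  induction w with
  | zero => simp [self hq]
  | succ w ih =>
    have h1 := succ_right_mul hq i (j + w)
    have h2 : gaussianBinomial q (j + w + 1) j * (q ^ (w + 1) - 1) =
        gaussianBinomial q (j + w) j * (q ^ (j + w + 1) - 1) := by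
      rw [← succ_succ_mul hq, succ_right_mul hq, add_assoc, Nat.add_sub_cancel_left]
    have h3 := succ_right_mul hq (i - j) w
    rw [Nat.sub_sub] at h3
    refine mul_right_cancel₀ (pow_succ_sub_one_ne_zero hq w)
      (mul_right_cancel₀ (pow_succ_sub_one_ne_zero hq (j + w)) ?_)
    rw [← add_assoc]
    calc _ = (gaussianBinomial q (j + w + 1) j * (q ^ (w + 1) - 1)) *
          (gaussianBinomial q i (j + w + 1) * (q ^ (j + w + 1) - 1)) := by ring
      _ = (gaussianBinomial q (j + w) j * gaussianBinomial q i (j + w)) *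
          ((q ^ (i - (j + w)) - 1) * (q ^ (j + w + 1) - 1)) := by rw [h1, h2]; ring
      _ = gaussianBinomial q i j * (gaussianBinomial q (i - j) (w + 1) * (q ^ (w + 1) - 1)) *
          (q ^ (j + w + 1) - 1) := by rw [ih, h3]; ring
      _ = _ := by ring

/-- Gaussian inversion: the two triangular matrices of signed and unsigned Gaussian binomial
coefficients are inverse to each other. -/
lemma inversion (hq : 1 < q) {i j k : ℕ} (hi : i < k) :
    ∑ v ∈ Finset.Icc j (k - 1), (-1 : ℚ) ^ (v - j) * q ^ ((v - j).choose 2) *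
      gaussianBinomial q v j * gaussianBinomial q i v = if i = j then 1 else 0 := by
  rcases lt_or_ge i j with h | h
  · rw [if_neg h.ne]
    refine Finset.sum_eq_zero fun v hv => ?_
    rw [eq_zero_of_lt (h.trans_le (Finset.mem_Icc.1 hv).1), mul_zero]
  have hI : Finset.Icc j (k - 1) = Finset.Ico (0 + j) ((k - j) + j) := by
    ext v; simp only [Finset.mem_Icc, Finset.mem_Ico]; omega
  rw [hI, ← Finset.sum_Ico_add', Nat.Ico_zero_eq_range]
  have hterm : ∀ w, (-1 : ℚ) ^ (w + j - j) * q ^ ((w + j - j).choose 2) *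
      gaussianBinomial q (w + j) j * gaussianBinomial q i (w + j) =
      gaussianBinomial q i j * ((-1) ^ w * q ^ (w.choose 2) * gaussianBinomial q (i - j) w) := by
    intro w
    rw [Nat.add_sub_cancel, mul_assoc, add_comm w j, mul_eq_mul hq]
    ring
  simp only [hterm]
  rw [← Finset.mul_sum]
  split_ifs with hij
  · subst hij
    rw [self hq, one_mul, Finset.sum_eq_single_of_mem 0 (Finset.mem_range.2 (by omega))]
    · simp
    · intro w _ hw
      rw [eq_zero_of_lt (by omega), mul_zero]
  · obtain ⟨a, ha⟩ : ∃ a, i - j = a + 1 := ⟨i - j - 1, by omega⟩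
    obtain ⟨t, ht⟩ : ∃ t, k - j = t + 1 := ⟨k - j - 1, by omega⟩
    rw [ha, ht, alternating_partial_sum hq, eq_zero_of_lt (show a < t by omega)]
    simp

/-- The Gaussian binomial coefficient as a quotient of numbers of linearly independent tuples. -/
lemma prod_pow_sub_pow (hq : 1 < q) (a b : ℕ) :
    ∏ i ∈ Finset.range b, (q ^ a - q ^ i) =
      gaussianBinomial q a b * ∏ i ∈ Finset.range b, (q ^ b - q ^ i) := by
  rcases lt_or_ge a b with h | h
  · rw [eq_zero_of_lt h, zero_mul]
    exact Finset.prod_eq_zero (Finset.mem_range.2 h) (sub_self _)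
  have key : ∀ c, b ≤ c → ∏ i ∈ Finset.range b, (q ^ c - q ^ i) =
      (∏ i ∈ Finset.range b, q ^ i) * ∏ i ∈ Finset.range b, (q ^ (c - i) - 1) := by
    intro c hc
    rw [← Finset.prod_mul_distrib]
    refine Finset.prod_congr rfl fun i hi => ?_
    rw [mul_sub, mul_one, ← pow_add, Nat.add_sub_cancel']
    exact (Finset.mem_range.1 hi).le.trans hc
  have hrefl : ∏ i ∈ Finset.range b, (q ^ (b - i) - 1) =
      ∏ i ∈ Finset.range b, (q ^ (i + 1) - 1) := by
    rw [← Finset.prod_range_reflect]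
    refine Finset.prod_congr rfl fun i hi => ?_
    rw [show b - (b - 1 - i) = i + 1 by have := Finset.mem_range.1 hi; omega]
  rw [key a h, key b le_rfl, hrefl, gaussianBinomial, Finset.prod_div_distrib]
  have h' : ∏ i ∈ Finset.range b, (q ^ (i + 1) - 1) ≠ 0 :=
    Finset.prod_ne_zero_iff.2 fun i _ => pow_succ_sub_one_ne_zero hq i
  field_simp

end gaussianBinomial

/-! ### Character sums over elementary abelian `2`-groups -/

/-- The nontrivial character `a ↦ (-1) ^ a` of `𝔽₂`. -/
def binarySign (a : ZMod 2) : ℤ := (-1) ^ a.val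

namespace binarySign

@[simp] lemma zero : binarySign 0 = 1 := by decide

lemma add (a b : ZMod 2) : binarySign (a + b) = binarySign a * binarySign b := by
  revert a b; decide

lemma eq_neg_one {a : ZMod 2} (h : a ≠ 0) : binarySign a = -1 := by
  revert a; decide

lemma mul_self (a : ZMod 2) : binarySign a * binarySign a = 1 := by
  revert a; decide

variable {X Y : Type*} [AddCommGroup X] [AddCommGroup Y] [Fintype X] [Fintype Y]

lemma sum_eq_zero {f : X →+ ZMod 2} {x₀ : X} (h : f x₀ ≠ 0) : ∑ x, binarySign (f x) = 0 := by
  have : ∑ x, binarySign (f x) = -∑ x, binarySign (f x) := by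
    conv_lhs => rw [← Equiv.sum_comp (Equiv.addLeft x₀)]
    simp [add, eq_neg_one h]
  omega

open scoped Classical in
lemma sum_eq_ite (f : X →+ ZMod 2) :
    ∑ x, binarySign (f x) = if ∀ x, f x = 0 then (Fintype.card X : ℤ) else 0 := by
  split_ifs with h
  · simp [h]
  · obtain ⟨x₀, hx₀⟩ := not_forall.1 h
    exact sum_eq_zero hx₀

open scoped Classical in
/-- A biadditive pairing of two finite groups with values in `𝔽₂` has left and right kernels of
the same index. -/
lemma card_mul_card_kernel (p : X →+ Y →+ ZMod 2) :
    Fintype.card X * (Finset.univ.filter fun y => ∀ x, p x y = 0).card =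
      Fintype.card Y * (Finset.univ.filter fun x => ∀ y, p x y = 0).card := by
  have h1 : ∑ x, ∑ y, binarySign (p x y) =
      Fintype.card Y * (Finset.univ.filter fun x => ∀ y, p x y = 0).card := by
    simp only [sum_eq_ite]
    rw [← Finset.sum_filter, Finset.sum_const, nsmul_eq_mul, mul_comm]
  have h2 : ∑ x, ∑ y, binarySign (p x y) =
      Fintype.card X * (Finset.univ.filter fun y => ∀ x, p x y = 0).card := by
    rw [Finset.sum_comm]
    have : ∀ y, ∑ x, binarySign (p x y) = if ∀ x, p x y = 0 then (Fintype.card X : ℤ) else 0 :=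
      fun y => sum_eq_ite (p.flip y)
    simp only [this]
    rw [← Finset.sum_filter, Finset.sum_const, nsmul_eq_mul, mul_comm]
  exact_mod_cast h2.symm.trans h1

end binarySign

/-! ### Walsh transforms of quadratic functions -/

section Walsh

open binarySign

variable {V : Type*} [AddCommGroup V] [Fintype V]

/-- The Walsh transform of `Q : V → 𝔽₂` at `b`, with respect to a pairing `ℓ` of `V` with
itself. -/
def walsh (ℓ : V →+ V →+ ZMod 2) (Q : V → ZMod 2) (b : V) : ℤ :=
  ∑ x, binarySign (ℓ b x + Q x)

variable {ℓ : V →+ V →+ ZMod 2} {Q : V → ZMod 2}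

lemma sum_walsh (hℓ : ∀ x, (∀ b, ℓ b x = 0) → x = 0) (hQ : Q 0 = 0) :
    ∑ b, walsh ℓ Q b = Fintype.card V := by
  simp only [walsh, binarySign.add]
  rw [Finset.sum_comm, Finset.sum_eq_single 0]
  · simp [hQ]
  · intro x _ hx
    have : ∃ b, ℓ b x ≠ 0 := by
      by_contra! h
      exact hx (hℓ x h)
    obtain ⟨b, hb⟩ := this
    have h0 : ∑ i, binarySign (ℓ i x) = 0 := sum_eq_zero (f := ℓ.flip x) (x₀ := b) hb
    rw [← Finset.sum_mul, h0, zero_mul]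
  · simp

variable {B : V →+ V →+ ZMod 2}

open scoped Classical in
lemma walsh_sq (hB : ∀ x y, Q (x + y) = Q x + Q y + B x y) (b : V) :
    walsh ℓ Q b ^ 2 = Fintype.card V *
      ∑ z ∈ Finset.univ.filter (fun z => ∀ y, B y z = 0), binarySign (ℓ b z + Q z) := by
  have h1 : walsh ℓ Q b ^ 2 =
      ∑ z, binarySign (ℓ b z + Q z) * ∑ x, binarySign (B.flip z x) := by
    rw [sq, walsh, Finset.sum_mul_sum]
    have : ∀ x, ∑ y, binarySign (ℓ b x + Q x) * binarySign (ℓ b y + Q y) =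
        ∑ z, binarySign (ℓ b z + Q z) * binarySign (B.flip z x) := by
      intro x
      rw [← Equiv.sum_comp (Equiv.addLeft x)]
      refine Finset.sum_congr rfl fun z _ => ?_
      rw [Equiv.coe_addLeft, hB, map_add, AddMonoidHom.flip_apply]
      simp only [binarySign.add]
      linear_combination (binarySign (ℓ b z) * binarySign (Q z) * binarySign (B x z)) *
        (binarySign (Q x) * binarySign (Q x) * mul_self (ℓ b x) + mul_self (Q x))
    simp only [this]
    rw [Finset.sum_comm]
    simp only [Finset.mul_sum]
  rw [h1, Finset.sum_filter, Finset.mul_sum]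
  refine Finset.sum_congr rfl fun z _ => ?_
  have hs := sum_eq_ite (B.flip z)
  by_cases h : ∀ y, B y z = 0
  · rw [if_pos h, hs, if_pos (show ∀ x, B.flip z x = 0 from h), mul_comm]
  · rw [if_neg h, hs, if_neg (fun h' => h fun x => h' x), mul_zero, mul_zero]

open scoped Classical in
/-- The squares of the Walsh coefficients of a quadratic function are `0` or `|V| |rad|`, because
the function is additive on its radical. -/
lemma walsh_sq_eq (hB : ∀ x y, Q (x + y) = Q x + Q y + B x y) (b : V) :
    walsh ℓ Q b = 0 ∨ walsh ℓ Q b ^ 2 =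
      Fintype.card V * (Finset.univ.filter fun z => ∀ y, B y z = 0).card := by
  have hQ : Q 0 = 0 := by simpa using hB 0 0
  let R : AddSubgroup V :=
    { carrier := {z | ∀ y, B y z = 0}
      add_mem' := fun {a c} ha hc y => by rw [map_add, ha, hc, add_zero]
      zero_mem' := fun y => map_zero _
      neg_mem' := fun {a} ha y => by rw [map_neg, ha, neg_zero] }
  let f : R →+ ZMod 2 :=
    { toFun := fun z => ℓ b z + Q z
      map_zero' := by simp [hQ]
      map_add' := fun x y => by
        rw [AddSubgroup.coe_add, hB, y.2 x, map_add]
        ring }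
  have hsum : ∑ z ∈ Finset.univ.filter (fun z => ∀ y, B y z = 0), binarySign (ℓ b z + Q z) =
      ∑ z, binarySign (f z) := by
    refine Finset.sum_subtype (p := fun z => z ∈ R) _ (fun z => ?_)
      (fun z => binarySign (ℓ b z + Q z))
    simp [R]
  have hcard : Fintype.card R = (Finset.univ.filter fun z => ∀ y, B y z = 0).card :=
    Fintype.card_of_subtype _ fun z => by simp [R]
  have h := walsh_sq (ℓ := ℓ) hB b
  rw [hsum, sum_eq_ite, hcard] at h
  split_ifs at h
  · exact Or.inr h
  · exact Or.inl (pow_eq_zero_iff two_ne_zero |>.1 (by simpa using h))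

open scoped Classical in
lemma sum_walsh_sq (hℓ : ∀ x, (∀ b, ℓ b x = 0) → x = 0)
    (hB : ∀ x y, Q (x + y) = Q x + Q y + B x y) :
    ∑ b, walsh ℓ Q b ^ 2 = (Fintype.card V : ℤ) ^ 2 := by
  have hQ : Q 0 = 0 := by simpa using hB 0 0
  simp only [walsh_sq hB, binarySign.add]
  rw [← Finset.mul_sum, Finset.sum_comm, Finset.sum_eq_single 0]
  · simp [hQ, sq]
  · intro x _ hx
    have : ∃ b, ℓ b x ≠ 0 := by
      by_contra! h
      exact hx (hℓ x h)
    obtain ⟨b, hb⟩ := this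
    have h0 : ∑ i, binarySign (ℓ i x) = 0 := sum_eq_zero (f := ℓ.flip x) (x₀ := b) hb
    rw [← Finset.sum_mul, h0, zero_mul]
  · simp

open scoped Classical in
/-- The value distribution of the Walsh transform of a quadratic function. It does not depend on
the type of the function, only on the size of its radical: the first two moments of the transform
determine how often each of the values `w` and `-w` is taken. -/
lemma card_walsh_eq (hℓ : ∀ x, (∀ b, ℓ b x = 0) → x = 0)
    (hB : ∀ x y, Q (x + y) = Q x + Q y + B x y) {w : ℤ} (hw : 0 < w)
    (hrad : Fintype.card V * ((Finset.univ.filter fun z => ∀ y, B y z = 0).card : ℤ) = w ^ 2)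
    {ε : ℤ} (hε : ε = 1 ∨ ε = -1) :
    2 * w ^ 2 * ((Finset.univ.filter fun b => walsh ℓ Q b = ε * w).card : ℤ) =
      (Fintype.card V : ℤ) ^ 2 + ε * w * Fintype.card V := by
  have hQ : Q 0 = 0 := by simpa using hB 0 0
  have hval : ∀ b, walsh ℓ Q b ^ 2 + ε * w * walsh ℓ Q b =
      2 * w ^ 2 * if walsh ℓ Q b = ε * w then 1 else 0 := by
    intro b
    have hε2 : ε * ε = 1 := by rcases hε with rfl | rfl <;> rfl
    rcases walsh_sq_eq (ℓ := ℓ) hB b with h | h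
    · have : (0 : ℤ) ≠ ε * w := by
        rcases hε with rfl | rfl <;> omega
      rw [h, if_neg this]
      ring
    · rw [hrad] at h
      have h' : (walsh ℓ Q b - ε * w) * (walsh ℓ Q b + ε * w) = 0 := by
        linear_combination h - w ^ 2 * hε2
      rcases mul_eq_zero.1 h' with h'' | h''
      · rw [sub_eq_zero.1 h'', if_pos rfl]
        linear_combination 2 * w ^ 2 * hε2
      · have : walsh ℓ Q b = -(ε * w) := by linarith
        rw [this, if_neg]
        · ring
        · rcases hε with rfl | rfl <;> omega
  rw [Finset.card_filter, Nat.cast_sum, Finset.mul_sum]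
  simp only [Nat.cast_ite, Nat.cast_one, Nat.cast_zero, ← hval]
  rw [Finset.sum_add_distrib, ← Finset.mul_sum, sum_walsh_sq hℓ hB, sum_walsh hℓ hQ]

end Walsh

/-! ### Two facts from linear algebra -/

section LinearAlgebra

variable {K V V₂ V₃ : Type*} [Field K] [AddCommGroup V] [Module K V] [FiniteDimensional K V]
  [AddCommGroup V₂] [Module K V₂] [FiniteDimensional K V₂] [AddCommGroup V₃] [Module K V₃]

lemma LinearMap.finrank_ker_comp_le (g : V₂ →ₗ[K] V₃) (f : V →ₗ[K] V₂) :
    finrank K (LinearMap.ker (g ∘ₗ f)) ≤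
      finrank K (LinearMap.ker f) + finrank K (LinearMap.ker g) := by
  have h := (f.domRestrict (LinearMap.ker (g ∘ₗ f))).finrank_range_add_finrank_ker
  have h1 : finrank K (LinearMap.range (f.domRestrict (LinearMap.ker (g ∘ₗ f)))) ≤
      finrank K (LinearMap.ker g) := by
    refine Submodule.finrank_mono ?_
    rintro _ ⟨x, rfl⟩
    exact x.2
  have h2 : finrank K (LinearMap.ker (f.domRestrict (LinearMap.ker (g ∘ₗ f)))) ≤
      finrank K (LinearMap.ker f) := by
    rw [← Submodule.finrank_map_subtype_eq]
    refine Submodule.finrank_mono ?_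
    rintro _ ⟨x, hx, rfl⟩
    exact hx
  omega

/-- An alternating form has even rank: a maximal totally isotropic subspace `U` satisfies
`U = Uᗮ`, so that `2 dim U = dim V + dim (ker B)`. -/
lemma LinearMap.BilinForm.IsAlt.exists_two_mul_finrank {B : LinearMap.BilinForm K V}
    (hB : B.IsAlt) :
    ∃ U : Submodule K V, 2 * finrank K U = finrank K V + finrank K (LinearMap.ker B) := by
  have hs : ∃ U : Submodule K V, U ≤ B.orthogonal U := ⟨⊥, bot_le⟩
  obtain ⟨U, hU⟩ := exists_maximal_of_wellFoundedGT
    (fun U : Submodule K V => U ≤ B.orthogonal U) hs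
  have hUU : B.orthogonal U = U := by
    refine le_antisymm (fun x hx => ?_) hU.1
    have h1 : U ⊔ K ∙ x ≤ B.orthogonal (U ⊔ K ∙ x) := by
      intro y hy z hz
      obtain ⟨u, hu, v, hv, rfl⟩ := Submodule.mem_sup.1 hy
      obtain ⟨u', hu', v', hv', rfl⟩ := Submodule.mem_sup.1 hz
      obtain ⟨a, rfl⟩ := Submodule.mem_span_singleton.1 hv
      obtain ⟨b, rfl⟩ := Submodule.mem_span_singleton.1 hv'
      have e1 : B u' u = 0 := hU.1 hu u' hu'
      have e2 : B u' x = 0 := hx u' hu'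
      have e3 : B x u = 0 := hB.isRefl.eq_zero (hx u hu)
      have e4 : B x x = 0 := hB x
      simp [e1, e2, e3, e4]
    exact hU.2 h1 le_sup_left (Submodule.mem_sup_right (Submodule.mem_span_singleton_self x))
  have hk : B.orthogonal ⊤ = LinearMap.ker B := LinearMap.BilinForm.orthogonal_top_eq_ker hB.isRefl
  have hle : LinearMap.ker B ≤ U := by
    rw [← hUU, ← hk]
    exact LinearMap.BilinForm.orthogonal_le le_top
  have h := LinearMap.BilinForm.finrank_add_finrank_orthogonal hB.isRefl U
  rw [hUU, hk, inf_eq_right.2 hle] at h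
  exact ⟨U, by omega⟩

end LinearAlgebra

/-! ### Linearized polynomials in a generator of the Galois group -/

section CyclicExtension

variable {K F : Type*} [Field K] [Field F] [Algebra K F] {σ : Gal(F/K)}

/-- The `K`-linear map `x ↦ ∑ l < r, c l * σ ^ l x`. -/
noncomputable def linearized (σ : Gal(F/K)) (r : ℕ) (c : ℕ → F) : F →ₗ[K] F :=
  ∑ l ∈ Finset.range r, c l • (σ ^ l).toLinearMap

lemma linearized_apply (r : ℕ) (c : ℕ → F) (x : F) :
    linearized σ r c x = ∑ l ∈ Finset.range r, c l * (σ ^ l) x := by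
  simp [linearized]

variable [FiniteDimensional K F] [IsGalois K F]

lemma zpowers_eq_top (hσ : orderOf σ = finrank K F) : Subgroup.zpowers σ = ⊤ := by
  refine Subgroup.eq_top_of_card_eq _ ?_
  rw [Nat.card_zpowers, hσ, IsGalois.card_aut_eq_finrank]

lemma mem_range_algebraMap_of_fixed (hσ : orderOf σ = finrank K F) {x : F} (hx : σ x = x) :
    ∃ a : K, algebraMap K F a = x := by
  refine (IsGalois.mem_range_algebraMap_iff_fixed x).2 fun f => ?_
  have hf : f ∈ Subgroup.zpowers σ := by rw [zpowers_eq_top hσ]; trivial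
  have : Subgroup.zpowers σ ≤ MulAction.stabilizer Gal(F/K) x :=
    Subgroup.zpowers_le.2 hx
  exact this hf

lemma algebraMap_trace_eq_sum (hσ : orderOf σ = finrank K F) (y : F) :
    algebraMap K F (Algebra.trace K F y) = ∑ l ∈ Finset.range (finrank K F), (σ ^ l) y := by
  classical
  rw [trace_eq_sum_automorphisms]
  have hinj : Set.InjOn (fun l : ℕ => σ ^ l) (Finset.range (finrank K F)) := by
    rw [← hσ, Finset.coe_range]
    exact pow_injOn_Iio_orderOf
  have huniv : (Finset.range (finrank K F)).image (fun l : ℕ => σ ^ l) = Finset.univ := by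
    refine Finset.eq_univ_of_card _ ?_
    rw [Finset.card_image_of_injOn hinj, Finset.card_range, ← Nat.card_eq_fintype_card,
      IsGalois.card_aut_eq_finrank]
  rw [← huniv, Finset.sum_image hinj]

lemma finrank_ker_sub_id_le (hσ : orderOf σ = finrank K F) :
    finrank K (LinearMap.ker (σ.toLinearMap - (LinearMap.id : F →ₗ[K] F))) ≤ 1 := by
  have h : LinearMap.ker (σ.toLinearMap - (LinearMap.id : F →ₗ[K] F)) ≤ K ∙ (1 : F) := by
    intro x hx
    have hx' : σ x = x := by simpa [sub_eq_zero] using hx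
    obtain ⟨a, ha⟩ := mem_range_algebraMap_of_fixed hσ hx'
    rw [Submodule.mem_span_singleton]
    exact ⟨a, by rw [← ha, Algebra.algebraMap_eq_smul_one]⟩
  exact (Submodule.finrank_mono h).trans (finrank_span_singleton (K := K) (one_ne_zero' F)).le

/-- A nonzero linearized polynomial of `σ`-degree at most `r` has a kernel of dimension at most
`r`. After a scaling by an element of the kernel, the constant `1` is a root, so that `σ - 1`
splits off on the right. -/
lemma finrank_ker_linearized_le (hσ : orderOf σ = finrank K F) (r : ℕ) {c : ℕ → F}
    (hc : ∃ l ≤ r, c l ≠ 0) : finrank K (LinearMap.ker (linearized σ (r + 1) c)) ≤ r := by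
  induction r generalizing c with
  | zero =>
    obtain ⟨l, hl, hcl⟩ := hc
    obtain rfl : l = 0 := by omega
    have : LinearMap.ker (linearized σ (0 + 1) c) = ⊥ := by
      rw [LinearMap.ker_eq_bot']
      intro x hx
      simpa [linearized_apply, hcl] using hx
    rw [this, finrank_bot]
  | succ r ih =>
    by_cases hbot : LinearMap.ker (linearized σ (r + 1 + 1) c) = ⊥
    · rw [hbot, finrank_bot]; omega
    obtain ⟨w, hw, hw0⟩ := Submodule.exists_mem_ne_zero_of_ne_bot hbot
    -- The partial sums of the coefficients of `x ↦ L (w * x)` are, up to sign, the coefficients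
    -- of its quotient by `σ - 1`.
    let b : ℕ → F := fun l => -∑ i ∈ Finset.range (l + 1), c i * (σ ^ i) w
    have hb : b (r + 1) = 0 := by
      simpa [b, linearized_apply] using hw
    have hsplit : ∀ (s : ℕ) (x : F), ∑ l ∈ Finset.range (s + 1), c l * (σ ^ l) (w * x) =
        ∑ l ∈ Finset.range s, b l * (σ ^ l) (σ x - x) - b s * (σ ^ s) x := by
      intro s x
      induction s with
      | zero => simp [b]; ring
      | succ s ihs =>
        rw [Finset.sum_range_succ, ihs, Finset.sum_range_succ]
        have hbs : b (s + 1) = b s - c (s + 1) * (σ ^ (s + 1)) w := by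
          simp only [b]
          rw [Finset.sum_range_succ _ (s + 1)]
          ring
        rw [hbs, map_sub, map_mul, ← AlgEquiv.mul_apply, ← pow_succ]
        ring
    have hcomp : ∀ x, linearized σ (r + 1 + 1) c (w * x) =
        linearized σ (r + 1) b ((σ.toLinearMap - (LinearMap.id : F →ₗ[K] F)) x) := by
      intro x
      rw [linearized_apply, hsplit, hb, linearized_apply, zero_mul, sub_zero]
      rfl
    have hbne : ∃ l ≤ r, b l ≠ 0 := by
      by_contra! hb0
      have hb0' : ∀ l ≤ r + 1, b l = 0 := fun l hl => by
        rcases Nat.le_succ_iff.1 hl with h | h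
        · exact hb0 l h
        · rw [h, hb]
      obtain ⟨l, hl, hcl⟩ := hc
      refine hcl ?_
      have hwl : (σ ^ l) w ≠ 0 := (map_ne_zero (σ ^ l)).2 hw0
      refine (mul_eq_zero.1 (?_ : c l * (σ ^ l) w = 0)).resolve_right hwl
      cases l with
      | zero => simpa [b] using hb0' 0 (by omega)
      | succ l =>
        have h1 := hb0' (l + 1) hl
        have h2 := hb0' l (by omega)
        simp only [b, neg_eq_zero] at h1 h2
        rwa [Finset.sum_range_succ, h2, zero_add] at h1
    have hker : LinearMap.ker (linearized σ (r + 1 + 1) c) =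
        (LinearMap.ker (linearized σ (r + 1) b ∘ₗ (σ.toLinearMap - (LinearMap.id : F →ₗ[K] F)))).map
          (LinearMap.mulLeft K w) := by
      ext x
      simp only [LinearMap.mem_ker, Submodule.mem_map, LinearMap.comp_apply]
      constructor
      · intro hx
        refine ⟨w⁻¹ * x, ?_, ?_⟩
        · rw [← hcomp, mul_inv_cancel_left₀ hw0, hx]
        · rw [LinearMap.mulLeft_apply, mul_inv_cancel_left₀ hw0]
      · rintro ⟨y, hy, rfl⟩
        rw [LinearMap.mulLeft_apply, hcomp, hy]
    rw [hker]
    refine (Submodule.finrank_map_le _ _).trans ((LinearMap.finrank_ker_comp_le _ _).trans ?_)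
    have h1 := finrank_ker_sub_id_le hσ
    have h2 := ih hbne
    omega

end CyclicExtension

/-! ### The dual description of alternating forms with prescribed vectors in the radical -/

section Coupling

variable {K F : Type*} [Field K] [Field F] [Algebra K F] {σ : Gal(F/K)} {u : ℕ}

/-- The coefficient of `σ ^ l` in the linearized polynomial that represents `∑ i, x i ∧ z i`, where
this stands for the form
`(y, w) ↦ ∑ i, (Tr (x i * y) * Tr (z i * w) + Tr (z i * y) * Tr (x i * w))` on `F`, which is
alternating in characteristic two. -/
def coupling (σ : Gal(F/K)) (x z : Fin u → F) (l : ℕ) : F :=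
  ∑ i, (z i * (σ ^ l) (x i) + x i * (σ ^ l) (z i))

lemma sum_range_add_of_periodic {M : Type*} [AddCommGroup M] {h : ℕ → M} {p : ℕ}
    (hh : ∀ l, h (l + p) = h l) (t : ℕ) :
    ∑ l ∈ Finset.range p, h (l + t) = ∑ l ∈ Finset.range p, h l := by
  induction t with
  | zero => simp
  | succ t ih =>
    rw [← ih]
    have h1 := Finset.sum_range_succ (fun l => h (l + t)) p
    rw [Finset.sum_range_succ', zero_add, add_comm p t, hh] at h1
    rw [← add_right_cancel h1]
    exact Finset.sum_congr rfl fun l _ => by rw [add_right_comm, add_assoc]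

variable {N : ℕ}

lemma pow_two_mul_apply (hσ : orderOf σ = finrank K F) (hN : finrank K F = 2 * N) (l : ℕ)
    (y : F) : (σ ^ (l + 2 * N)) y = (σ ^ l) y := by
  rw [pow_add, ← hN, ← hσ, pow_orderOf_eq_one, mul_one]

lemma coupling_self_add (hσ : orderOf σ = finrank K F) (hN : finrank K F = 2 * N)
    (x z : Fin u → F) {a b : ℕ} (hab : a + b = 2 * N) :
    (σ ^ a) (coupling σ x z b) = coupling σ x z a := by
  have h : ∀ y, (σ ^ a) ((σ ^ b) y) = y := fun y => by
    rw [← AlgEquiv.mul_apply, ← pow_add, hab, ← Nat.zero_add (2 * N),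
      pow_two_mul_apply hσ hN, pow_zero, AlgEquiv.one_apply]
  simp only [coupling, map_sum, map_add, map_mul, h]
  exact Finset.sum_congr rfl fun i _ => by ring

variable [FiniteDimensional K F] [IsGalois K F]

lemma exists_trace_dual {x : Fin u → F} (hx : LinearIndependent K x) :
    ∃ y : Fin u → F, ∀ i j, Algebra.trace K F (x i * y j) = if i = j then 1 else 0 := by
  let T : F →ₗ[K] (Fin u → K) := LinearMap.pi fun i => Algebra.traceForm K F (x i)
  have hT : LinearMap.range T = ⊤ := by
    by_contra hne
    obtain ⟨f, hf0, hf⟩ := Submodule.exists_le_ker_of_lt_top _ (lt_top_iff_ne_top.2 hne)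
    have hsum : ∀ v : Fin u → K, f v = ∑ i, v i * f (Pi.single i 1) := by
      intro v
      rw [LinearMap.pi_apply_eq_sum_univ f v]
      simp only [smul_eq_mul]
      refine Finset.sum_congr rfl fun i _ => ?_
      congr 2
      ext j
      simp [Pi.single_apply, eq_comm]
    have h0 : ∑ i, f (Pi.single i 1) • x i = 0 := by
      refine (traceForm_nondegenerate K F).1 _ fun y => ?_
      have hy : f (T y) = 0 := hf ⟨y, rfl⟩
      rw [hsum] at hy
      rw [map_sum, LinearMap.sum_apply, ← hy]
      refine Finset.sum_congr rfl fun i _ => ?_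
      simp [T, mul_comm]
    have hz := Fintype.linearIndependent_iff.1 hx _ h0
    exact hf0 (LinearMap.ext fun v => by rw [hsum]; simp [hz])
  choose y hy using fun j => LinearMap.range_eq_top.1 hT (Pi.single j 1)
  refine ⟨y, fun i j => ?_⟩
  have := congrFun (hy j) i
  simpa [T, Algebra.traceForm_apply, Pi.single_apply] using this

/-- The form `∑ i, x i ∧ z i` has rank at most `2 u`. If its coefficients at
`σ ^ (N - j)`, `j < k`, vanish then its coefficients vanish in a whole interval around `N`, which
forces rank at least `2 k` unless the form is zero. -/
lemma sum_trace_eq_zero_of_coupling (hσ : orderOf σ = finrank K F) (hN : finrank K F = 2 * N)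
    {k : ℕ} (hu : u < k) (hk : k ≤ N) {x z : Fin u → F}
    (h : ∀ j < k, coupling σ x z (N - j) = 0) (y : F) :
    ∑ i, (z i * algebraMap K F (Algebra.trace K F (x i * y)) +
      x i * algebraMap K F (Algebra.trace K F (z i * y))) = 0 := by
  set g : ℕ → F := coupling σ x z with hg
  have hlow : ∀ j < k, g (N + j) = 0 := by
    intro j hj
    rw [← map_eq_zero (σ ^ (N - j)), hg, coupling_self_add hσ hN x z (by omega)]
    exact h j hj
  have hper : ∀ l, g (l + 2 * N) = g l := fun l => by
    simp only [hg, coupling, pow_two_mul_apply hσ hN]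
  let c : ℕ → F := fun l => g (l + (N + k))
  have hform : ∀ y, ∑ i, (z i * algebraMap K F (Algebra.trace K F (x i * y)) +
      x i * algebraMap K F (Algebra.trace K F (z i * y))) =
      linearized σ (2 * (N - k) + 1) c ((σ ^ (N + k)) y) := by
    intro y
    have h1 : ∑ i, (z i * algebraMap K F (Algebra.trace K F (x i * y)) +
        x i * algebraMap K F (Algebra.trace K F (z i * y))) =
        ∑ l ∈ Finset.range (2 * N), g l * (σ ^ l) y := by
      simp only [algebraMap_trace_eq_sum hσ, hN, hg, coupling, Finset.mul_sum, Finset.sum_mul,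
        ← Finset.sum_add_distrib]
      rw [Finset.sum_comm]
      refine Finset.sum_congr rfl fun l _ => Finset.sum_congr rfl fun i _ => ?_
      rw [map_mul, map_mul]
      ring
    rw [h1, ← sum_range_add_of_periodic (h := fun l => g l * (σ ^ l) y)
      (fun l => by rw [hper, pow_two_mul_apply hσ hN]) (N + k), linearized_apply]
    symm
    have hterm : ∀ l, g (l + (N + k)) * (σ ^ (l + (N + k))) y =
        c l * (σ ^ l) ((σ ^ (N + k)) y) := fun l => by
      rw [pow_add, AlgEquiv.mul_apply]
    simp only [hterm]
    refine Finset.sum_subset (Finset.range_mono (by omega)) fun l hl hl' => ?_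
    rw [Finset.mem_range] at hl hl'
    have hc : c l = 0 := by
      rcases le_or_gt (3 * N) (l + (N + k)) with h3 | h3
      · have := hlow (l + (N + k) - 3 * N) (by omega)
        rw [← hper] at this
        rwa [show N + (l + (N + k) - 3 * N) + 2 * N = l + (N + k) by omega] at this
      · have := h (3 * N - (l + (N + k))) (by omega)
        rw [← hper] at this
        rwa [show N - (3 * N - (l + (N + k))) + 2 * N = l + (N + k) by omega] at this
    rw [hc, zero_mul]
  rw [hform]
  by_cases hc : ∃ l ≤ 2 * (N - k), c l ≠ 0
  · exfalso
    let T : F →ₗ[K] (Fin u ⊕ Fin u → K) :=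
      LinearMap.pi (Sum.elim (fun i => Algebra.traceForm K F (x i))
        (fun i => Algebra.traceForm K F (z i)))
    have h1 := T.finrank_range_add_finrank_ker
    have h2 : finrank K (LinearMap.range T) ≤ 2 * u := by
      refine (Submodule.finrank_le _).trans ?_
      simp [two_mul]
    have h3 : (LinearMap.ker T).map ((σ ^ (N + k)).toLinearEquiv : F →ₗ[K] F) ≤
        LinearMap.ker (linearized σ (2 * (N - k) + 1) c) := by
      rintro _ ⟨y, hy, rfl⟩
      have hx0 : ∀ i, Algebra.trace K F (x i * y) = 0 := fun i => congrFun hy (Sum.inl i)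
      have hz0 : ∀ i, Algebra.trace K F (z i * y) = 0 := fun i => congrFun hy (Sum.inr i)
      have := hform y
      simp only [hx0, hz0, map_zero, mul_zero, add_zero, Finset.sum_const_zero] at this
      exact this.symm
    have h4 := (Submodule.finrank_mono h3).trans (finrank_ker_linearized_le hσ _ hc)
    rw [LinearEquiv.finrank_map_eq] at h4
    omega
  · push Not at hc
    rw [linearized_apply]
    refine Finset.sum_eq_zero fun l hl => ?_
    rw [hc l (by have := Finset.mem_range.1 hl; omega), zero_mul]

/-- The tuples `z` for which `∑ i, x i ∧ z i` has no coefficients around the middle are those for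
which this form is zero, so they are given by the symmetric matrices over `K`. -/
lemma card_coupling_eq_zero [CharP F 2] (hσ : orderOf σ = finrank K F) (hN : finrank K F = 2 * N)
    {k : ℕ} (hu : u < k) (hk : k ≤ N) {x : Fin u → F} (hx : LinearIndependent K x) :
    Nat.card {z : Fin u → F // ∀ j < k, coupling σ x z (N - j) = 0} =
      Nat.card K ^ (u + 1).choose 2 := by
  have hmem : ∀ f : Sym2 (Fin u) → K, ∀ l,
      coupling σ x (fun i => ∑ j, f s(i, j) • x j) l = 0 := by
    intro f l
    simp only [coupling, map_sum, map_smul, Finset.sum_add_distrib, Finset.mul_sum,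
      Finset.sum_mul]
    rw [Finset.sum_comm (f := fun i j => x i * f s(i, j) • (σ ^ l) (x j)),
      ← Finset.sum_add_distrib]
    refine Finset.sum_eq_zero fun i _ => ?_
    rw [← Finset.sum_add_distrib]
    refine Finset.sum_eq_zero fun j _ => ?_
    rw [Sym2.eq_swap, smul_mul_assoc, mul_smul_comm]
    exact CharTwo.add_self_eq_zero _
  have hbij : Function.Bijective (fun f : Sym2 (Fin u) → K =>
      (⟨fun i => ∑ j, f s(i, j) • x j, fun j _ => hmem f _⟩ :
        {z : Fin u → F // ∀ j < k, coupling σ x z (N - j) = 0})) := by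
    constructor
    · intro f f' hff
      funext s
      induction s using Sym2.ind with
      | _ i j =>
        have h1 := congrFun (congrArg Subtype.val hff) i
        have h2 : ∑ j, (f s(i, j) - f' s(i, j)) • x j = 0 := by
          simp only [sub_smul, Finset.sum_sub_distrib]
          exact sub_eq_zero.2 h1
        exact sub_eq_zero.1 (Fintype.linearIndependent_iff.1 hx _ h2 j)
    · rintro ⟨z, hz⟩
      obtain ⟨y, hy⟩ := exists_trace_dual hx
      have hz' : ∀ j, z j = ∑ i, Algebra.trace K F (z i * y j) • x i := by
        intro j
        have h1 := sum_trace_eq_zero_of_coupling hσ hN hu hk hz (y j)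
        simp only [hy, Finset.sum_add_distrib] at h1
        rw [Finset.sum_eq_single j (fun i _ hij => by simp [hij]) (by simp)] at h1
        rw [if_pos rfl, map_one, mul_one] at h1
        rw [CharTwo.add_eq_zero.1 h1]
        exact Finset.sum_congr rfl fun i _ => by rw [Algebra.smul_def, mul_comm]
      have hsymm : ∀ i j, Algebra.trace K F (z i * y j) = Algebra.trace K F (z j * y i) := by
        intro i j
        conv_lhs => rw [hz' i]
        rw [Finset.sum_mul, map_sum, Finset.sum_eq_single j]
        · rw [smul_mul_assoc, map_smul, hy, if_pos rfl, smul_eq_mul, mul_one]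
        · intro l _ hl
          rw [smul_mul_assoc, map_smul, hy, if_neg hl, smul_zero]
        · simp
      refine ⟨Sym2.lift ⟨fun i j => Algebra.trace K F (z i * y j), hsymm⟩, ?_⟩
      refine Subtype.ext (funext fun i => ?_)
      change ∑ j, Algebra.trace K F (z i * y j) • x j = z i
      simp only [hsymm i]
      exact (hz' i).symm
  rw [← Nat.card_congr (Equiv.ofBijective _ hbij), Nat.card_fun,
    Nat.card_eq_fintype_card (α := Sym2 (Fin u)), Sym2.card, Fintype.card_fin]

end Coupling

/-! ### The quadratic forms of the code and their radicals -/

section Family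

variable {K F : Type*} [Field K] [Field F] [Algebra K F] {σ : Gal(F/K)} {N k : ℕ}

/-- The `K`-linear map `L` for which `(x, y) ↦ Tr (L x * y)` is the polarization of the quadratic
form `x ↦ ∑ j, Tr (β j * (x * σ ^ (N - j) x))`. -/
noncomputable def polarMap (σ : Gal(F/K)) (N : ℕ) {k : ℕ} (β : Fin k → F) : F →ₗ[K] F :=
  ∑ j : Fin k, (β j • (σ ^ (N - j : ℕ)).toLinearMap +
    (σ ^ (N + j : ℕ)).toLinearMap ∘ₗ LinearMap.mulLeft K (β j))

lemma polarMap_apply (β : Fin k → F) (x : F) : polarMap σ N β x =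
    ∑ j : Fin k, (β j * (σ ^ (N - j : ℕ)) x + (σ ^ (N + j : ℕ)) (β j * x)) := by
  simp [polarMap]

/-- The quadratic form `x ↦ ∑ j, Tr (β j * (x * σ ^ (N - j) x))` with values in `𝔽₂`. -/
noncomputable def traceQuadratic [Algebra (ZMod 2) F] (σ : Gal(F/K)) (N : ℕ) {k : ℕ}
    (β : Fin k → F) (x : F) : ZMod 2 :=
  ∑ j : Fin k, Algebra.trace (ZMod 2) F (β j * (x * (σ ^ (N - j : ℕ)) x))

lemma traceQuadratic_single [Algebra (ZMod 2) F] [DecidableEq (Fin k)] (j : Fin k) (c x : F) :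
    traceQuadratic σ N (Pi.single j c) x =
      Algebra.trace (ZMod 2) F (c * (x * (σ ^ (N - j : ℕ)) x)) := by
  rw [traceQuadratic, Finset.sum_eq_single j]
  · rw [Pi.single_eq_same]
  · intro i _ hi
    rw [Pi.single_eq_of_ne hi, zero_mul, map_zero]
  · simp

lemma pow_sub_pow_add_apply (hσ : orderOf σ = finrank K F) (hN : finrank K F = 2 * N) {j : ℕ}
    (hj : j ≤ N) (y : F) : (σ ^ (N - j)) ((σ ^ (N + j)) y) = y := by
  rw [← AlgEquiv.mul_apply, ← pow_add, show N - j + (N + j) = 0 + 2 * N by omega,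
    pow_two_mul_apply hσ hN, pow_zero, AlgEquiv.one_apply]

lemma trace_mul_polarMap {A : Type*} [Field A] [Algebra A F]
    (hA : ∀ (l : ℕ) (y : F), Algebra.trace A F ((σ ^ l) y) = Algebra.trace A F y)
    (hσ : orderOf σ = finrank K F) (hN : finrank K F = 2 * N) (hk : k ≤ N)
    (β : Fin k → F) (x z : F) : Algebra.trace A F (z * polarMap σ N β x) =
      ∑ j : Fin k, Algebra.trace A F
        (β j * (z * (σ ^ (N - j : ℕ)) x + x * (σ ^ (N - j : ℕ)) z)) := by
  rw [polarMap_apply, Finset.mul_sum, map_sum]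
  refine Finset.sum_congr rfl fun j _ => ?_
  have h1 : Algebra.trace A F (z * (σ ^ (N + j : ℕ)) (β j * x)) =
      Algebra.trace A F (β j * (x * (σ ^ (N - j : ℕ)) z)) := by
    rw [← hA (N - j), map_mul, pow_sub_pow_add_apply hσ hN (j.2.le.trans hk)]
    congr 1
    ring
  rw [mul_add, map_add, h1, ← map_add]
  congr 1
  ring

lemma trace_gal_apply (l : ℕ) (y : F) : Algebra.trace K F ((σ ^ l) y) = Algebra.trace K F y :=
  Algebra.trace_eq_of_algEquiv (σ ^ l) y

lemma trace_zmod_gal_apply [Algebra (ZMod 2) K] [Algebra (ZMod 2) F] [IsScalarTower (ZMod 2) K F]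
    (l : ℕ) (y : F) :
    Algebra.trace (ZMod 2) F ((σ ^ l) y) = Algebra.trace (ZMod 2) F y :=
  Algebra.trace_eq_of_algEquiv ((σ ^ l).restrictScalars (ZMod 2)) y

lemma traceQuadratic_add [Algebra (ZMod 2) K] [Algebra (ZMod 2) F] [IsScalarTower (ZMod 2) K F]
    (hσ : orderOf σ = finrank K F) (hN : finrank K F = 2 * N) (hk : k ≤ N)
    (β : Fin k → F) (x y : F) : traceQuadratic σ N β (x + y) =
      traceQuadratic σ N β x + traceQuadratic σ N β y +
        Algebra.trace (ZMod 2) F (x * polarMap σ N β y) := by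
  rw [trace_mul_polarMap trace_zmod_gal_apply hσ hN hk]
  simp only [traceQuadratic, ← Finset.sum_add_distrib, ← map_add]
  refine Finset.sum_congr rfl fun j _ => ?_
  rw [map_add (σ ^ (N - j : ℕ))]
  congr 1
  ring

lemma range_involution_le_ker [CharP F 2] (hσ : orderOf σ = finrank K F)
    (hN : finrank K F = 2 * N) :
    LinearMap.range ((σ ^ N).toLinearMap - (LinearMap.id : F →ₗ[K] F)) ≤
      LinearMap.ker ((σ ^ N).toLinearMap - (LinearMap.id : F →ₗ[K] F)) := by
  rintro _ ⟨x, rfl⟩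
  have hx : (σ ^ N) ((σ ^ N) x) = x := by
    simpa using pow_sub_pow_add_apply hσ hN (Nat.zero_le N) x
  change (σ ^ N) ((σ ^ N) x - x) - ((σ ^ N) x - x) = 0
  rw [map_sub, hx]
  linear_combination (x - (σ ^ N) x) * CharTwo.two_eq_zero (R := F)

/-- The coefficients of the polarization as a linearized polynomial, shifted so as to start at
`σ ^ (N - (k - 1))`. -/
def polarCoeff (σ : Gal(F/K)) (N : ℕ) {k : ℕ} (β : Fin k → F) (l : ℕ) : F :=
  ∑ j : Fin k, ((if l = k - 1 - j then β j else 0) +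
    (if l = k - 1 + j then (σ ^ (N + j : ℕ)) (β j) else 0))

lemma polarMap_eq_linearized (hk : k ≤ N) (β : Fin k → F) (x : F) :
    polarMap σ N β x =
      linearized σ (2 * (k - 1) + 1) (polarCoeff σ N β) ((σ ^ (N - (k - 1))) x) := by
  simp only [linearized_apply, polarCoeff, Finset.sum_mul, polarMap_apply]
  rw [Finset.sum_comm]
  refine Finset.sum_congr rfl fun j _ => ?_
  have hj := j.2
  simp only [add_mul, Finset.sum_add_distrib, ite_mul, zero_mul, Finset.sum_ite_eq',
    ← AlgEquiv.mul_apply, ← pow_add]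
  rw [if_pos (Finset.mem_range.2 (by omega)), if_pos (Finset.mem_range.2 (by omega)), map_mul,
    show k - 1 - j + (N - (k - 1)) = N - j by omega,
    show k - 1 + j + (N - (k - 1)) = N + j by omega]

lemma polarCoeff_sub (β : Fin k → F) (j : Fin k) :
    polarCoeff σ N β (k - 1 - j) = β j + if (j : ℕ) = 0 then (σ ^ N) (β j) else 0 := by
  have hj := j.2
  rw [polarCoeff, Finset.sum_add_distrib]
  congr 1
  · rw [Finset.sum_eq_single j]
    · simp
    · intro i _ hij
      have := i.2
      exact if_neg fun h => hij (Fin.ext (by omega))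
    · simp
  · split_ifs with h0
    · rw [Finset.sum_eq_single j]
      · simp [h0]
      · intro i _ hij
        have := i.2
        exact if_neg fun h => hij (Fin.ext (by omega))
      · simp
    · exact Finset.sum_eq_zero fun i _ => if_neg (by omega)

variable [FiniteDimensional K F] [IsGalois K F]

/-- The radicals are even-dimensional, as the polar form is alternating. -/
lemma even_finrank_ker_polarMap [CharP F 2] (hσ : orderOf σ = finrank K F)
    (hN : finrank K F = 2 * N) (hk : k ≤ N) (β : Fin k → F) :
    ∃ i, finrank K (LinearMap.ker (polarMap σ N β)) = 2 * i := by
  let B : LinearMap.BilinForm K F := Algebra.traceForm K F ∘ₗ polarMap σ N β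
  have hker : LinearMap.ker B = LinearMap.ker (polarMap σ N β) := by
    refine LinearMap.ker_comp_of_ker_eq_bot _ ?_
    rw [LinearMap.ker_eq_bot']
    exact fun x hx => (traceForm_nondegenerate K F).1 x fun y => by rw [hx]; rfl
  have hB : B.IsAlt := by
    intro x
    change Algebra.trace K F (polarMap σ N β x * x) = 0
    rw [mul_comm, trace_mul_polarMap trace_gal_apply hσ hN hk]
    refine Finset.sum_eq_zero fun j _ => ?_
    rw [CharTwo.add_self_eq_zero, mul_zero, map_zero]
  obtain ⟨U, hU⟩ := hB.exists_two_mul_finrank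
  rw [hker, hN] at hU
  exact ⟨finrank K U - N, by omega⟩

lemma finrank_ker_polarMap_le (hσ : orderOf σ = finrank K F) (hk : k ≤ N) {β : Fin k → F}
    {l : ℕ} (hl : l ≤ 2 * (k - 1)) (hβ : polarCoeff σ N β l ≠ 0) :
    finrank K (LinearMap.ker (polarMap σ N β)) ≤ 2 * (k - 1) := by
  have h := finrank_ker_linearized_le hσ (2 * (k - 1)) ⟨l, hl, hβ⟩
  rw [← LinearEquiv.finrank_map_eq (σ ^ (N - (k - 1))).toLinearEquiv]
  refine (Submodule.finrank_mono ?_).trans h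
  rintro _ ⟨x, hx, rfl⟩
  exact (polarMap_eq_linearized hk β x).symm.trans hx

lemma polarMap_eq_zero_or (hσ : orderOf σ = finrank K F) (hk : k ≤ N) (β : Fin k → F) :
    polarMap σ N β = 0 ∨ finrank K (LinearMap.ker (polarMap σ N β)) ≤ 2 * (k - 1) := by
  by_cases h : ∃ l ≤ 2 * (k - 1), polarCoeff σ N β l ≠ 0
  · obtain ⟨l, hl, hl'⟩ := h
    exact Or.inr (finrank_ker_polarMap_le hσ hk hl hl')
  · push Not at h
    refine Or.inl (LinearMap.ext fun x => ?_)
    rw [polarMap_eq_linearized hk, linearized_apply]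
    exact Finset.sum_eq_zero fun l hl => by
      rw [h l (by have := Finset.mem_range.1 hl; omega), zero_mul]

lemma finrank_ker_polarMap_of_ne_zero (hσ : orderOf σ = finrank K F) (hk : k ≤ N)
    {β : Fin k → F} (hβ : polarMap σ N β ≠ 0) :
    finrank K (LinearMap.ker (polarMap σ N β)) ≤ 2 * (k - 1) :=
  (polarMap_eq_zero_or hσ hk β).resolve_left hβ

/-- The only relation among the coefficients `β` is that `β 0` matters only up to elements fixed
by the involution `σ ^ N`. -/
lemma polarMap_eq_zero_iff [CharP F 2] (hσ : orderOf σ = finrank K F)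
    (hN : finrank K F = 2 * N) (hk0 : 0 < k) (hk : k ≤ N) (β : Fin k → F) :
    polarMap σ N β = 0 ↔
      (σ ^ N) (β ⟨0, hk0⟩) = β ⟨0, hk0⟩ ∧ ∀ j : Fin k, (j : ℕ) ≠ 0 → β j = 0 := by
  constructor
  · intro h
    have hc : ∀ j : Fin k, polarCoeff σ N β (k - 1 - j) = 0 := by
      intro j
      by_contra hne
      have := finrank_ker_polarMap_le hσ hk (by omega) hne
      rw [h, LinearMap.ker_zero, finrank_top, hN] at this
      omega
    constructor
    · have := hc ⟨0, hk0⟩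
      rw [polarCoeff_sub, if_pos rfl] at this
      exact (CharTwo.add_eq_zero.1 this).symm
    · intro j hj
      have := hc j
      rwa [polarCoeff_sub, if_neg hj, add_zero] at this
  · rintro ⟨h0, h1⟩
    ext x
    rw [polarMap_apply, LinearMap.zero_apply, Finset.sum_eq_single ⟨0, hk0⟩]
    · simp only [Nat.sub_zero, Nat.add_zero, map_mul, h0]
      exact CharTwo.add_self_eq_zero _
    · intro j _ hj
      rw [h1 j fun h => hj (Fin.ext h)]
      simp
    · simp

lemma finrank_fixed_involution [CharP F 2] (hσ : orderOf σ = finrank K F)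
    (hN : finrank K F = 2 * N) :
    finrank K (LinearMap.ker ((σ ^ N).toLinearMap - (LinearMap.id : F →ₗ[K] F))) = N := by
  have hN0 : 0 < N := by
    have := finrank_pos (R := K) (M := F)
    omega
  refine le_antisymm ?_ ?_
  · let c : ℕ → F := fun l => (if l = N then 1 else 0) - (if l = 0 then 1 else 0)
    have hlin : (σ ^ N).toLinearMap - (LinearMap.id : F →ₗ[K] F) = linearized σ (N + 1) c := by
      ext x
      rw [linearized_apply]
      simp [c, sub_mul, Finset.sum_sub_distrib]
    rw [hlin]
    exact finrank_ker_linearized_le hσ N ⟨N, le_rfl, by simp [c, hN0.ne']⟩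
  · have h := ((σ ^ N).toLinearMap - (LinearMap.id : F →ₗ[K] F)).finrank_range_add_finrank_ker
    have := Submodule.finrank_mono (range_involution_le_ker hσ hN)
    omega

/-- In characteristic two, the elements fixed by the involution `σ ^ N` are the elements
`σ ^ N w - w`. -/
lemma exists_sub_eq_of_fixed [CharP F 2] (hσ : orderOf σ = finrank K F) (hN : finrank K F = 2 * N)
    {y : F} (hy : (σ ^ N) y = y) : ∃ w, (σ ^ N) w - w = y := by
  have h1 := ((σ ^ N).toLinearMap - (LinearMap.id : F →ₗ[K] F)).finrank_range_add_finrank_ker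
  have h2 := finrank_fixed_involution hσ hN
  have h3 := Submodule.eq_of_le_of_finrank_eq (range_involution_le_ker hσ hN) (by omega)
  have h4 : y ∈ LinearMap.ker ((σ ^ N).toLinearMap - (LinearMap.id : F →ₗ[K] F)) :=
    sub_eq_zero.2 hy
  rw [← h3] at h4
  exact h4

lemma card_polarMap_eq_zero [CharP F 2] (hσ : orderOf σ = finrank K F)
    (hN : finrank K F = 2 * N) (hk0 : 0 < k) (hk : k ≤ N) :
    Nat.card {β : Fin k → F // polarMap σ N β = 0} = Nat.card K ^ N := by
  have e : {β : Fin k → F // polarMap σ N β = 0} ≃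
      LinearMap.ker ((σ ^ N).toLinearMap - (LinearMap.id : F →ₗ[K] F)) :=
    { toFun := fun β => ⟨β.1 ⟨0, hk0⟩, sub_eq_zero.2
        ((polarMap_eq_zero_iff hσ hN hk0 hk β.1).1 β.2).1⟩
      invFun := fun b => ⟨Pi.single ⟨0, hk0⟩ b.1, (polarMap_eq_zero_iff hσ hN hk0 hk _).2
        ⟨by rw [Pi.single_eq_same]; exact sub_eq_zero.1 b.2, fun j hj =>
          Pi.single_eq_of_ne (fun h => hj (by rw [h])) _⟩⟩
      left_inv := fun β => by
        refine Subtype.ext (funext fun j => ?_)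
        by_cases hj : j = ⟨0, hk0⟩
        · subst hj
          simp
        · rw [((polarMap_eq_zero_iff hσ hN hk0 hk β.1).1 β.2).2 j fun h => hj (Fin.ext h)]
          exact Pi.single_eq_of_ne hj _
      right_inv := fun b => by simp }
  rw [Nat.card_congr e, Module.natCard_eq_pow_finrank (K := K), finrank_fixed_involution hσ hN]

end Family

/-! ### Moments of the radicals -/

section Moments

variable {K F : Type*} [Field K] [Field F] [Algebra K F] {σ : Gal(F/K)} {N k : ℕ}

lemma coupling_add {u : ℕ} (x z z' : Fin u → F) (l : ℕ) :
    coupling σ x (z + z') l = coupling σ x z l + coupling σ x z' l := by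
  simp only [coupling, ← Finset.sum_add_distrib, Pi.add_apply, map_add]
  exact Finset.sum_congr rfl fun i _ => by ring

lemma finrank_sup_span_singleton_of_notMem [FiniteDimensional K F] {U : Submodule K F}
    {x : F} (hx : x ∉ U) : finrank K ↥(U ⊔ K ∙ x) = finrank K U + 1 := by
  have hx0 : x ≠ 0 := fun h => hx (h ▸ U.zero_mem)
  have h := Submodule.finrank_sup_add_finrank_inf_eq U (K ∙ x)
  have hd : U ⊓ K ∙ x = ⊥ := disjoint_iff.1 ((Submodule.disjoint_span_singleton' hx0).2 hx)
  rw [hd, finrank_bot, finrank_span_singleton hx0] at h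
  exact h

/-- The pairing between coefficient vectors `β` and tuples `z` given by
`∑ i, Tr (z i * L (x i))`, where `L` is the polar map of `β`. -/
noncomputable def couplingPairing [Algebra (ZMod 2) F] (σ : Gal(F/K)) (N k : ℕ) {u : ℕ}
    (x : Fin u → F) : (Fin k → F) →+ (Fin u → F) →+ ZMod 2 :=
  AddMonoidHom.mk' (fun β => AddMonoidHom.mk'
    (fun z => ∑ j : Fin k, Algebra.trace (ZMod 2) F (β j * coupling σ x z (N - j)))
    (fun z z' => by simp only [coupling_add, mul_add, map_add, Finset.sum_add_distrib]))
    (fun β β' => by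
      refine AddMonoidHom.ext fun z => ?_
      simp only [AddMonoidHom.mk'_apply, AddMonoidHom.add_apply, Pi.add_apply, add_mul, map_add,
        Finset.sum_add_distrib])

lemma couplingPairing_apply [Algebra (ZMod 2) F] {u : ℕ} (x : Fin u → F) (β : Fin k → F)
    (z : Fin u → F) : couplingPairing σ N k x β z =
      ∑ j : Fin k, Algebra.trace (ZMod 2) F (β j * coupling σ x z (N - j)) := rfl

lemma couplingPairing_eq [Algebra (ZMod 2) K] [Algebra (ZMod 2) F] [IsScalarTower (ZMod 2) K F]
    (hσ : orderOf σ = finrank K F) (hN : finrank K F = 2 * N) (hk : k ≤ N) {u : ℕ}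
    (x : Fin u → F) (β : Fin k → F) (z : Fin u → F) :
    couplingPairing σ N k x β z =
      ∑ i, Algebra.trace (ZMod 2) F (z i * polarMap σ N β (x i)) := by
  simp only [trace_mul_polarMap trace_zmod_gal_apply hσ hN hk, couplingPairing_apply, coupling,
    Finset.mul_sum, map_sum]
  exact Finset.sum_comm

lemma eq_zero_of_trace_mul [Finite F] [Algebra (ZMod 2) F] {a : F}
    (h : ∀ y, Algebra.trace (ZMod 2) F (a * y) = 0) : a = 0 :=
  (traceForm_nondegenerate (ZMod 2) F).1 a h

variable [Fintype F]

open scoped Classical in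
/-- The forms of the family whose radical contains a given subspace. -/
noncomputable def formsAbove (σ : Gal(F/K)) (N k : ℕ) (U : Submodule K F) :
    Finset (Fin k → F) :=
  Finset.univ.filter fun β => U ≤ LinearMap.ker (polarMap σ N β)

lemma mem_formsAbove {U : Submodule K F} {β : Fin k → F} :
    β ∈ formsAbove σ N k U ↔ U ≤ LinearMap.ker (polarMap σ N β) := by
  simp [formsAbove]

open scoped Classical in
/-- Double counting of the pairs of a form and a vector of its radical outside of `U`. -/
lemma sum_formsAbove_mul (U : Submodule K F) (f : (Fin k → F) → ℚ) :
    ∑ β ∈ formsAbove σ N k U,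
        ((Nat.card (LinearMap.ker (polarMap σ N β)) : ℚ) - Nat.card U) * f β =
      ∑ x ∈ Finset.univ.filter (fun x => x ∉ U), ∑ β ∈ formsAbove σ N k (U ⊔ K ∙ x), f β := by
  have h1 : ∀ β ∈ formsAbove σ N k U,
      ((Nat.card (LinearMap.ker (polarMap σ N β)) : ℚ) - Nat.card U) * f β =
      ∑ x ∈ Finset.univ.filter (fun x => x ∉ U), if polarMap σ N β x = 0 then f β else 0 := by
    intro β hβ
    rw [mem_formsAbove] at hβ
    rw [← Finset.sum_filter, Finset.sum_const, nsmul_eq_mul, Finset.filter_filter]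
    congr 1
    have hs : (Finset.univ.filter fun x => x ∉ U ∧ polarMap σ N β x = 0) =
        (Finset.univ.filter fun x => x ∈ LinearMap.ker (polarMap σ N β)) \
          (Finset.univ.filter fun x => x ∈ U) := by
      ext x
      simp [and_comm]
    have hsub : (Finset.univ.filter fun x => x ∈ U) ⊆
        (Finset.univ.filter fun x => x ∈ LinearMap.ker (polarMap σ N β)) :=
      Finset.monotone_filter_right _ fun x _ hx => hβ hx
    rw [hs, Finset.card_sdiff_of_subset hsub, Nat.cast_sub (Finset.card_le_card hsub)]
    congr 2 <;> rw [Nat.card_eq_fintype_card, Fintype.card_subtype]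
  rw [Finset.sum_congr rfl h1, Finset.sum_comm]
  refine Finset.sum_congr rfl fun x _ => ?_
  rw [← Finset.sum_filter]
  refine Finset.sum_congr ?_ fun _ _ => rfl
  ext β
  rw [Finset.mem_filter, mem_formsAbove, mem_formsAbove, sup_le_iff,
    Submodule.span_singleton_le_iff_mem, LinearMap.mem_ker]

variable [Algebra (ZMod 2) K] [Algebra (ZMod 2) F] [IsScalarTower (ZMod 2) K F]

variable [FiniteDimensional K F] [IsGalois K F] [CharP F 2]

/-- The proportion of the forms whose radical contains a given subspace of small dimension is the
same as among all alternating forms. -/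
lemma card_formsAbove (hσ : orderOf σ = finrank K F) (hN : finrank K F = 2 * N) (hk : k ≤ N)
    {U : Submodule K F} (hU : finrank K U < k) :
    (formsAbove σ N k U).card * Nat.card F ^ finrank K U =
      Nat.card F ^ k * Nat.card K ^ (finrank K U + 1).choose 2 := by
  classical
  set u := finrank K U with hu
  let b := finBasis K U
  let x : Fin u → F := fun i => (b i : F)
  have hx : LinearIndependent K x := b.linearIndependent.map' U.subtype U.ker_subtype
  have hspan : ∀ β : Fin k → F, U ≤ LinearMap.ker (polarMap σ N β) ↔
      ∀ i, polarMap σ N β (x i) = 0 := by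
    intro β
    constructor
    · exact fun h i => h (b i).2
    · intro h y hy
      have hy' : ∑ i, b.repr ⟨y, hy⟩ i • x i = y := by
        have h' := congrArg Subtype.val (b.sum_repr ⟨y, hy⟩)
        rwa [AddSubmonoidClass.coe_finsetSum] at h'
      rw [LinearMap.mem_ker, ← hy', map_sum]
      exact Finset.sum_eq_zero fun i _ => by rw [map_smul, h i, smul_zero]
  have h := binarySign.card_mul_card_kernel (couplingPairing σ N k x)
  have h1 : (Finset.univ.filter fun β => ∀ z, couplingPairing σ N k x β z = 0) =
      formsAbove σ N k U := by
    ext β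
    rw [mem_formsAbove, hspan, Finset.mem_filter, and_iff_right (Finset.mem_univ _)]
    simp only [couplingPairing_eq hσ hN hk]
    constructor
    · intro hβ i
      refine eq_zero_of_trace_mul fun y => ?_
      have := hβ (Pi.single i y)
      rwa [Finset.sum_eq_single i (fun j _ hj => by rw [Pi.single_eq_of_ne hj, zero_mul, map_zero])
        (by simp), Pi.single_eq_same, mul_comm] at this
    · intro hβ z
      exact Finset.sum_eq_zero fun i _ => by rw [hβ, mul_zero, map_zero]
  have h2 : (Finset.univ.filter fun z => ∀ β, couplingPairing σ N k x β z = 0).card =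
      Nat.card K ^ (u + 1).choose 2 := by
    rw [← card_coupling_eq_zero hσ hN hU hk hx, Nat.card_eq_fintype_card, Fintype.card_subtype]
    congr 1
    ext z
    rw [Finset.mem_filter, Finset.mem_filter, and_iff_right (Finset.mem_univ _),
      and_iff_right (Finset.mem_univ _)]
    simp only [couplingPairing_apply]
    constructor
    · intro hz j hj
      refine eq_zero_of_trace_mul fun y => ?_
      have := hz (Pi.single ⟨j, hj⟩ y)
      rwa [Finset.sum_eq_single ⟨j, hj⟩
        (fun i _ hi => by rw [Pi.single_eq_of_ne hi, zero_mul, map_zero]) (by simp),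
        Pi.single_eq_same, mul_comm] at this
    · intro hz β
      exact Finset.sum_eq_zero fun j _ => by rw [hz j j.2, mul_zero, map_zero]
  rw [h1, h2] at h
  rw [Fintype.card_fun, Fintype.card_fun, Fintype.card_fin, Fintype.card_fin,
    ← Nat.card_eq_fintype_card] at h
  rw [h, mul_comm]

lemma card_formsAbove_sup (hσ : orderOf σ = finrank K F) (hN : finrank K F = 2 * N) (hk : k ≤ N)
    {U : Submodule K F} (hU : finrank K U + 1 < k) {x : F} (hx : x ∉ U) :
    ((formsAbove σ N k (U ⊔ K ∙ x)).card : ℚ) * (Nat.card K : ℚ) ^ (2 * N) =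
      (formsAbove σ N k U).card * (Nat.card K : ℚ) ^ (finrank K U + 1) := by
  have hf := finrank_sup_span_singleton_of_notMem hx
  have h1 := card_formsAbove hσ hN hk (U := U) (by omega)
  have h2 := card_formsAbove hσ hN hk (U := U ⊔ K ∙ x) (by omega)
  have hF : Nat.card F = Nat.card K ^ (2 * N) := by
    rw [Module.natCard_eq_pow_finrank (K := K), hN]
  have hch : (finrank K U + 1 + 1).choose 2 = finrank K U + 1 + (finrank K U + 1).choose 2 := by
    rw [Nat.choose_succ_succ' (finrank K U + 1) 1, Nat.choose_one_right]
  rw [hf, hch, pow_add (Nat.card K), pow_succ (Nat.card F)] at h2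
  have hpos : 0 < Nat.card F ^ finrank K U := pow_pos Nat.card_pos _
  have key : (formsAbove σ N k (U ⊔ K ∙ x)).card * Nat.card K ^ (2 * N) =
      (formsAbove σ N k U).card * Nat.card K ^ (finrank K U + 1) := by
    refine Nat.eq_of_mul_eq_mul_right hpos ?_
    rw [← hF]
    calc _ = (formsAbove σ N k (U ⊔ K ∙ x)).card * (Nat.card F ^ finrank K U * Nat.card F) := by
          ring
      _ = (Nat.card F ^ k * Nat.card K ^ (finrank K U + 1).choose 2) *
          Nat.card K ^ (finrank K U + 1) := by rw [h2]; ring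
      _ = _ := by rw [← h1]; ring
  exact_mod_cast key

/-- The moments of the sizes of the radicals. The polynomials `∏ i < v, (R - q ^ (2 (t + i)))`,
whose roots are possible sizes of radicals, make the recursion on the subspace `U` close up. -/
lemma sum_formsAbove_prod (hσ : orderOf σ = finrank K F) (hN : finrank K F = 2 * N) (hk : k ≤ N)
    {q : ℚ} (hq : q = Nat.card K) (v : ℕ) : ∀ (t : ℕ) (U : Submodule K F),
    finrank K U + v < k → finrank K U = 2 * t ∨ finrank K U + 1 = 2 * t →
    ∑ β ∈ formsAbove σ N k U, ∏ i ∈ Finset.range v,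
        ((Nat.card (LinearMap.ker (polarMap σ N β)) : ℚ) - q ^ (2 * (t + i))) =
      (formsAbove σ N k U).card *
        (if finrank K U = 2 * t then q ^ (2 * t + 1) else q ^ finrank K U) ^ v *
        ∏ i ∈ Finset.range v, (1 - q ^ (2 * (t + i)) / q ^ (2 * N)) := by
  classical
  have hq0 : q ≠ 0 := by
    have : Finite K := Finite.of_injective _ (algebraMap K F).injective
    rw [hq]
    exact_mod_cast Nat.card_pos.ne'
  have hcard : ∀ U : Submodule K F, (Nat.card U : ℚ) = q ^ finrank K U := fun U => by
    rw [Module.natCard_eq_pow_finrank (K := K), Nat.cast_pow, hq]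
  have hcompl : ∀ U : Submodule K F,
      ((Finset.univ.filter fun x => x ∉ U).card : ℚ) = q ^ (2 * N) - q ^ finrank K U := by
    intro U
    have h := Finset.card_filter_add_card_filter_not (s := (Finset.univ : Finset F))
      (fun x => x ∈ U)
    have h1 : ((Finset.univ.filter fun x => x ∈ U).card : ℚ) = q ^ finrank K U := by
      rw [← hcard, Nat.card_eq_fintype_card, Fintype.card_subtype]
    have h2 : ((Finset.univ : Finset F).card : ℚ) = q ^ (2 * N) := by
      rw [Finset.card_univ, ← Nat.card_eq_fintype_card, Module.natCard_eq_pow_finrank (K := K), hN,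
        Nat.cast_pow, hq]
    rw [← h1, ← h2, ← h]
    push_cast
    ring
  have hratio : ∀ (U : Submodule K F) (x : F), finrank K U + 1 < k → x ∉ U →
      ((formsAbove σ N k (U ⊔ K ∙ x)).card : ℚ) =
        (formsAbove σ N k U).card * (q ^ (finrank K U + 1) / q ^ (2 * N)) := by
    intro U x hU hx
    have := card_formsAbove_sup hσ hN hk hU hx
    rw [← hq] at this
    field_simp
    linear_combination this
  induction v with
  | zero => intro t U _ _; simp
  | succ v ih =>
    intro t U hU ht
    rcases ht with ht | ht
    · -- Even case: split off the first factor `R - |U|`.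
      have hstep := sum_formsAbove_mul (σ := σ) (N := N) (k := k) U fun β =>
        ∏ i ∈ Finset.range v,
          ((Nat.card (LinearMap.ker (polarMap σ N β)) : ℚ) - q ^ (2 * (t + 1 + i)))
      have hl : ∀ β : Fin k → F, ∏ i ∈ Finset.range (v + 1),
          ((Nat.card (LinearMap.ker (polarMap σ N β)) : ℚ) - q ^ (2 * (t + i))) =
          ((Nat.card (LinearMap.ker (polarMap σ N β)) : ℚ) - Nat.card U) *
          ∏ i ∈ Finset.range v,
            ((Nat.card (LinearMap.ker (polarMap σ N β)) : ℚ) - q ^ (2 * (t + 1 + i))) := by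
        intro β
        rw [Finset.prod_range_succ', mul_comm, hcard U, ht]
        simp only [add_assoc, add_comm 1, add_zero]
      simp only [hl]
      rw [hstep]
      have hterm : ∀ x ∈ Finset.univ.filter (fun x => x ∉ U),
          ∑ β ∈ formsAbove σ N k (U ⊔ K ∙ x), ∏ i ∈ Finset.range v,
            ((Nat.card (LinearMap.ker (polarMap σ N β)) : ℚ) - q ^ (2 * (t + 1 + i))) =
          (formsAbove σ N k U).card * (q ^ (2 * t + 1) / q ^ (2 * N)) * (q ^ (2 * t + 1)) ^ v *
            ∏ i ∈ Finset.range v, (1 - q ^ (2 * (t + 1 + i)) / q ^ (2 * N)) := by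
        intro x hx
        have hx' : x ∉ U := (Finset.mem_filter.1 hx).2
        have hf := finrank_sup_span_singleton_of_notMem hx'
        rw [ih (t + 1) _ (by omega) (Or.inr (by omega)), if_neg (by omega), hf,
          hratio U x (by omega) hx', ht]
      rw [Finset.sum_congr rfl hterm, Finset.sum_const, nsmul_eq_mul, hcompl, if_pos ht,
        Finset.prod_range_succ', ht]
      simp only [add_assoc, add_comm 1, add_zero]
      field_simp
      ring
    · -- Odd case: split off the last factor.
      have hstep := sum_formsAbove_mul (σ := σ) (N := N) (k := k) U fun β =>
        ∏ i ∈ Finset.range v,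
          ((Nat.card (LinearMap.ker (polarMap σ N β)) : ℚ) - q ^ (2 * (t + i)))
      have hterm : ∀ x ∈ Finset.univ.filter (fun x => x ∉ U),
          ∑ β ∈ formsAbove σ N k (U ⊔ K ∙ x), ∏ i ∈ Finset.range v,
            ((Nat.card (LinearMap.ker (polarMap σ N β)) : ℚ) - q ^ (2 * (t + i))) =
          (formsAbove σ N k U).card * (q ^ (2 * t) / q ^ (2 * N)) * (q ^ (2 * t + 1)) ^ v *
            ∏ i ∈ Finset.range v, (1 - q ^ (2 * (t + i)) / q ^ (2 * N)) := by
        intro x hx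
        have hx' : x ∉ U := (Finset.mem_filter.1 hx).2
        have hf := finrank_sup_span_singleton_of_notMem hx'
        rw [ih t _ (by omega) (Or.inl (by omega)), if_pos (by omega),
          hratio U x (by omega) hx', ht]
      rw [Finset.sum_congr rfl hterm, Finset.sum_const, nsmul_eq_mul, hcompl, hcard U] at hstep
      have hl : ∀ β : Fin k → F, ∏ i ∈ Finset.range (v + 1),
          ((Nat.card (LinearMap.ker (polarMap σ N β)) : ℚ) - q ^ (2 * (t + i))) =
          ((Nat.card (LinearMap.ker (polarMap σ N β)) : ℚ) - q ^ finrank K U) *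
          ∏ i ∈ Finset.range v,
            ((Nat.card (LinearMap.ker (polarMap σ N β)) : ℚ) - q ^ (2 * (t + i))) +
          (q ^ finrank K U - q ^ (2 * (t + v))) * ∏ i ∈ Finset.range v,
            ((Nat.card (LinearMap.ker (polarMap σ N β)) : ℚ) - q ^ (2 * (t + i))) := by
        intro β
        rw [Finset.prod_range_succ]
        ring
      simp only [hl]
      rw [Finset.sum_add_distrib, hstep, ← Finset.mul_sum, ih t U (by omega) (Or.inr ht),
        if_neg (by omega), Finset.prod_range_succ]
      obtain ⟨u, hu⟩ : ∃ u, finrank K U = u := ⟨_, rfl⟩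
      rw [hu] at ht ⊢
      rw [mul_add 2 t v, ← ht]
      field_simp
      ring

end Moments

/-! ### The rank distribution -/

section RankDistribution

variable {K F : Type*} [Field K] [Field F] [Algebra K F] [Fintype F] {σ : Gal(F/K)} {N k : ℕ}
  [Algebra (ZMod 2) K] [Algebra (ZMod 2) F] [IsScalarTower (ZMod 2) K F]
  [FiniteDimensional K F] [IsGalois K F] [CharP F 2]

/-- The moments of the rank distribution, in terms of Gaussian binomial coefficients: on average,
the radicals behave as for random alternating forms. -/
lemma sum_gaussianBinomial (hσ : orderOf σ = finrank K F) (hN : finrank K F = 2 * N) (hk : k ≤ N)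
    {q : ℚ} (hq : q = Nat.card K) {i : (Fin k → F) → ℕ}
    (hi : ∀ β, finrank K (LinearMap.ker (polarMap σ N β)) = 2 * i β) {v : ℕ} (hv : v < k) :
    ∑ β, gaussianBinomial (q ^ 2) (i β) v =
      q ^ N * gaussianBinomial (q ^ 2) N v * q ^ (N * (2 * k - 1 - 2 * v) + v) := by
  have : Finite K := Finite.of_injective _ (algebraMap K F).injective
  have hq1 : 1 < q := by
    rw [hq]
    exact_mod_cast Finite.one_lt_card
  have hq2 : 1 < q ^ 2 := one_lt_pow₀ hq1 two_ne_zero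
  have hq0 : q ≠ 0 := by positivity
  have h := sum_formsAbove_prod (σ := σ) (k := k) hσ hN hk hq v 0 ⊥ (by simpa using hv)
    (Or.inl (by simp))
  have htop : formsAbove σ N k ⊥ = Finset.univ :=
    Finset.eq_univ_of_forall fun β => mem_formsAbove.2 bot_le
  have hcard : ((Finset.univ : Finset (Fin k → F)).card : ℚ) = (q ^ (2 * N)) ^ k := by
    rw [Finset.card_univ, Fintype.card_fun, Fintype.card_fin, ← Nat.card_eq_fintype_card,
      Module.natCard_eq_pow_finrank (K := K), hN, hq]
    push_cast
    rfl
  set D := ∏ i ∈ Finset.range v, ((q ^ 2) ^ v - (q ^ 2) ^ i) with hD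
  have hD0 : D ≠ 0 := by
    refine Finset.prod_ne_zero_iff.2 fun i hi => sub_ne_zero.2 ?_
    exact (pow_lt_pow_right₀ hq2 (Finset.mem_range.1 hi)).ne'
  have hl : ∀ β : Fin k → F, ∏ l ∈ Finset.range v,
      ((Nat.card (LinearMap.ker (polarMap σ N β)) : ℚ) - q ^ (2 * (0 + l))) =
      gaussianBinomial (q ^ 2) (i β) v * D := by
    intro β
    rw [hD, ← gaussianBinomial.prod_pow_sub_pow hq2, Module.natCard_eq_pow_finrank (K := K), hi,
      Nat.cast_pow, ← hq]
    simp only [pow_mul, zero_add]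
  have hr : ∏ l ∈ Finset.range v, (1 - q ^ (2 * (0 + l)) / q ^ (2 * N)) =
      gaussianBinomial (q ^ 2) N v * D / (q ^ (2 * N)) ^ v := by
    rw [hD, ← gaussianBinomial.prod_pow_sub_pow hq2, eq_div_iff (by positivity)]
    conv_lhs => rw [← Finset.card_range v, ← Finset.prod_const, Finset.card_range]
    rw [← Finset.prod_mul_distrib]
    refine Finset.prod_congr rfl fun l _ => ?_
    rw [zero_add, sub_mul, one_mul, div_mul_cancel₀ _ (by positivity), pow_mul, pow_mul]
  rw [htop, hcard, hr] at h
  simp only [hl] at h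
  rw [← Finset.sum_mul, if_pos (by simp)] at h
  refine mul_right_cancel₀ hD0 (h.trans ?_)
  obtain ⟨w, rfl⟩ : ∃ w, k = v + 1 + w := ⟨k - (v + 1), by omega⟩
  rw [show 2 * (v + 1 + w) - 1 - 2 * v = 2 * w + 1 by omega]
  field_simp
  ring

open scoped Classical in
/-- The number of coefficient vectors whose quadratic form has a radical of dimension `2 j`. -/
lemma card_finrank_ker_eq (hσ : orderOf σ = finrank K F) (hN : finrank K F = 2 * N)
    (hk : k ≤ N) {q : ℚ} (hq : q = Nat.card K) {j : ℕ} (hj : j < k) :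
    ((Finset.univ.filter fun β : Fin k → F =>
        finrank K (LinearMap.ker (polarMap σ N β)) = 2 * j).card : ℚ) =
      q ^ N * ∑ v ∈ Finset.Icc j (k - 1), (-1 : ℚ) ^ (v - j) * (q ^ 2) ^ ((v - j).choose 2) *
        gaussianBinomial (q ^ 2) v j * gaussianBinomial (q ^ 2) N v *
        (q ^ (N * (2 * k - 1 - 2 * v) + v) - 1) := by
  have : Finite K := Finite.of_injective _ (algebraMap K F).injective
  have hq1 : 1 < q := by
    rw [hq]
    exact_mod_cast Finite.one_lt_card
  have hq2 : 1 < q ^ 2 := one_lt_pow₀ hq1 two_ne_zero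
  choose i hi using fun β : Fin k → F => even_finrank_ker_polarMap hσ hN hk β
  have hi0 : ∀ β : Fin k → F, polarMap σ N β = 0 → i β = N := by
    intro β hβ
    have := hi β
    rw [hβ, LinearMap.ker_zero, finrank_top, hN] at this
    omega
  have hsum : ∀ v < k, ∑ β ∈ Finset.univ.filter (fun β : Fin k → F => ¬ polarMap σ N β = 0),
      gaussianBinomial (q ^ 2) (i β) v =
      q ^ N * gaussianBinomial (q ^ 2) N v * (q ^ (N * (2 * k - 1 - 2 * v) + v) - 1) := by
    intro v hv
    have h1 := Finset.sum_filter_add_sum_filter_not Finset.univ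
      (fun β : Fin k → F => polarMap σ N β = 0) fun β => gaussianBinomial (q ^ 2) (i β) v
    have h2 : ∑ β ∈ Finset.univ.filter (fun β : Fin k → F => polarMap σ N β = 0),
        gaussianBinomial (q ^ 2) (i β) v = q ^ N * gaussianBinomial (q ^ 2) N v := by
      rw [Finset.sum_congr rfl fun β hβ => by rw [hi0 β (Finset.mem_filter.1 hβ).2],
        Finset.sum_const, nsmul_eq_mul, ← Fintype.card_subtype, ← Nat.card_eq_fintype_card,
        card_polarMap_eq_zero hσ hN (by omega) hk, Nat.cast_pow, hq]
    rw [sum_gaussianBinomial hσ hN hk hq hi hv, h2] at h1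
    linear_combination h1
  have hcount : ((Finset.univ.filter fun β : Fin k → F =>
        finrank K (LinearMap.ker (polarMap σ N β)) = 2 * j).card : ℚ) =
      ∑ β ∈ Finset.univ.filter (fun β : Fin k → F => ¬ polarMap σ N β = 0),
        if i β = j then 1 else 0 := by
    rw [← Finset.sum_filter, Finset.filter_filter, Finset.sum_const, nsmul_eq_mul, mul_one]
    congr 2
    ext β
    simp only [Finset.mem_filter, Finset.mem_univ, true_and, hi]
    constructor
    · intro h
      refine ⟨fun h0 => ?_, by omega⟩
      have := hi0 β h0
      omega
    · rintro ⟨_, h⟩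
      omega
  have hinv : ∀ β ∈ Finset.univ.filter (fun β : Fin k → F => ¬ polarMap σ N β = 0),
      (if i β = j then (1 : ℚ) else 0) =
      ∑ v ∈ Finset.Icc j (k - 1), (-1 : ℚ) ^ (v - j) * (q ^ 2) ^ ((v - j).choose 2) *
        gaussianBinomial (q ^ 2) v j * gaussianBinomial (q ^ 2) (i β) v := by
    intro β hβ
    have h1 := finrank_ker_polarMap_of_ne_zero hσ hk (Finset.mem_filter.1 hβ).2
    rw [hi] at h1
    rw [gaussianBinomial.inversion hq2 (by omega)]
  rw [hcount, Finset.sum_congr rfl hinv, Finset.sum_comm, Finset.mul_sum]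
  refine Finset.sum_congr rfl fun v hv => ?_
  rw [← Finset.mul_sum, hsum v (by have := Finset.mem_Icc.1 hv; omega)]
  ring

end RankDistribution

/-! ### The trace representation of maximum-length sequences -/

namespace BinSeq

open Polynomial

variable {M : ℕ}

/-- The shift by one position, as a linear operator. -/
def shiftOp (M : ℕ) : Module.End (ZMod 2) (BinSeq M) :=
  LinearMap.funLeft (ZMod 2) (ZMod 2) fun i : ZMod M => i + 1

lemma shiftOp_pow_apply (l : ℕ) (s : BinSeq M) : (shiftOp M ^ l) s = shift (l : ZMod M) s := by
  induction l with
  | zero => funext i; simp [shift]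
  | succ l ih =>
    rw [pow_succ', Module.End.mul_apply, ih]
    funext i
    simp [shiftOp, shift, add_assoc, add_comm (1 : ZMod M)]

/-- The polynomials in the shift operator that annihilate a sequence. -/
noncomputable def annihilatorIdeal (s : BinSeq M) : Ideal (ZMod 2)[X] where
  carrier := {g | aeval (shiftOp M) g s = 0}
  add_mem' {g h} hg hh := by
    change aeval (shiftOp M) (g + h) s = 0
    rw [map_add, LinearMap.add_apply, hg, hh, add_zero]
  zero_mem' := by
    change aeval (shiftOp M) 0 s = 0
    rw [map_zero, LinearMap.zero_apply]
  smul_mem' g h hh := by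
    change aeval (shiftOp M) (g * h) s = 0
    rw [map_mul, Module.End.mul_apply, hh, map_zero]

lemma mem_annihilatorIdeal {s : BinSeq M} {g : (ZMod 2)[X]} :
    g ∈ annihilatorIdeal s ↔ aeval (shiftOp M) g s = 0 := Iff.rfl

lemma mk_eq_mk_iff {s : BinSeq M} {g h : (ZMod 2)[X]} :
    Ideal.Quotient.mk (annihilatorIdeal s) g = Ideal.Quotient.mk (annihilatorIdeal s) h ↔
      aeval (shiftOp M) g s = aeval (shiftOp M) h s := by
  rw [Ideal.Quotient.eq, mem_annihilatorIdeal, map_sub, LinearMap.sub_apply, sub_eq_zero]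

lemma aeval_shiftOp_X_pow (s : BinSeq M) (l : ℕ) :
    aeval (shiftOp M) (X ^ l : (ZMod 2)[X]) s = shift (l : ZMod M) s := by
  rw [map_pow, aeval_X, shiftOp_pow_apply]

lemma aeval_shiftOp_C_mul_X_pow (s : BinSeq M) (c : ZMod 2) (l : ℕ) :
    aeval (shiftOp M) (C c * X ^ l) s = c • shift (l : ZMod M) s := by
  rw [map_mul, aeval_C, Module.End.mul_apply, aeval_shiftOp_X_pow]
  rfl

variable {m : ℕ} {s : BinSeq (2 ^ m - 1)}

namespace IsMaximumLength

lemma shift_injective (hs : IsMaximumLength m s) :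
    Function.Injective fun t : ZMod (2 ^ m - 1) => shift t s := by
  intro t t' h
  have h0 : shift (t - t') s = s := by
    funext i
    have := congrFun h (i - t')
    simp only [shift] at this ⊢
    rw [show i + (t - t') = i - t' + t by ring, this, sub_add_cancel]
  exact sub_eq_zero.1 (hs.2.2 _ h0)

lemma shift_ne_zero (hs : IsMaximumLength m s) (t : ZMod (2 ^ m - 1)) : shift t s ≠ 0 := by
  intro h
  refine hs.1 (funext fun i => ?_)
  have := congrFun h (i - t)
  simpa [shift] using this

/-- By the recurrence, the polynomials in the shift operator produce at most `2 ^ m` sequences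
from `s`. The zero sequence and the shifts of `s` already are `2 ^ m` sequences. -/
lemma exists_shift_eq (hm : 0 < m) (hs : IsMaximumLength m s) (g : (ZMod 2)[X])
    (hg : aeval (shiftOp (2 ^ m - 1)) g s ≠ 0) :
    ∃ t : ZMod (2 ^ m - 1), aeval (shiftOp (2 ^ m - 1)) g s = shift t s := by
  classical
  have hP : 1 < 2 ^ m := Nat.one_lt_two_pow hm.ne'
  have : NeZero (2 ^ m - 1) := ⟨by omega⟩
  obtain ⟨a, ha⟩ := hs.2.1
  let Φ : (Fin m → ZMod 2) → BinSeq (2 ^ m - 1) :=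
    fun c => ∑ l : Fin m, c l • shift ((l : ℕ) : ZMod (2 ^ m - 1)) s
  let p : (ZMod 2)[X] := ∑ l : Fin m, C (a l) * X ^ (l : ℕ)
  have hpdeg : p.degree < m := by
    refine (degree_sum_le _ _).trans_lt ((Finset.sup_lt_iff (WithBot.bot_lt_coe m)).2 ?_)
    exact fun l _ => (degree_C_mul_X_pow_le _ _).trans_lt (Nat.cast_lt.2 l.2)
  have hmonic : (X ^ m - p).Monic := monic_X_pow_sub hpdeg
  have hker : aeval (shiftOp (2 ^ m - 1)) (X ^ m - p) s = 0 := by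
    rw [map_sub, LinearMap.sub_apply, aeval_shiftOp_X_pow, sub_eq_zero, map_sum, LinearMap.sum_apply]
    funext i
    rw [Finset.sum_apply]
    refine (ha i).trans (Finset.sum_congr rfl fun l _ => ?_)
    rw [aeval_shiftOp_C_mul_X_pow]
    rfl
  have hΦ : ∀ h : (ZMod 2)[X], ∃ c, aeval (shiftOp (2 ^ m - 1)) h s = Φ c := by
    intro h
    have hdeg : (h %ₘ (X ^ m - p)).natDegree < m := by
      have h1 := degree_modByMonic_lt h hmonic
      rw [degree_sub_eq_left_of_degree_lt (by rwa [degree_X_pow]), degree_X_pow] at h1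
      rcases eq_or_ne (h %ₘ (X ^ m - p)) 0 with h0 | h0
      · rwa [h0, natDegree_zero]
      · exact (natDegree_lt_iff_degree_lt h0).2 h1
    refine ⟨fun l => (h %ₘ (X ^ m - p)).coeff l, ?_⟩
    have h1 : aeval (shiftOp (2 ^ m - 1)) h s =
        aeval (shiftOp (2 ^ m - 1)) (h %ₘ (X ^ m - p)) s := by
      conv_lhs => rw [← modByMonic_add_div h (X ^ m - p)]
      rw [map_add, LinearMap.add_apply, mul_comm, map_mul, Module.End.mul_apply, hker, map_zero,
        add_zero]
    rw [h1]
    conv_lhs => rw [as_sum_range' _ m hdeg]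
    rw [map_sum, LinearMap.sum_apply, ← Fin.sum_univ_eq_sum_range
      (fun l => aeval (shiftOp (2 ^ m - 1)) (monomial l ((h %ₘ (X ^ m - p)).coeff l)) s)]
    exact Finset.sum_congr rfl fun l _ => by
      rw [← C_mul_X_pow_eq_monomial, aeval_shiftOp_C_mul_X_pow]
  let T : Finset (BinSeq (2 ^ m - 1)) :=
    insert 0 (Finset.univ.image fun t : ZMod (2 ^ m - 1) => shift t s)
  have hTcard : T.card = 2 ^ m := by
    rw [Finset.card_insert_of_notMem, Finset.card_image_of_injective _ hs.shift_injective,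
      Finset.card_univ, ZMod.card]
    · omega
    · intro h
      obtain ⟨t, _, ht⟩ := Finset.mem_image.1 h
      exact hs.shift_ne_zero t ht
  have hsub : T ⊆ Finset.univ.image Φ := by
    intro x hx
    obtain ⟨h, rfl⟩ : ∃ h : (ZMod 2)[X], aeval (shiftOp (2 ^ m - 1)) h s = x := by
      rcases Finset.mem_insert.1 hx with rfl | hx
      · exact ⟨0, by simp⟩
      · obtain ⟨t, _, rfl⟩ := Finset.mem_image.1 hx
        exact ⟨X ^ t.val, by rw [aeval_shiftOp_X_pow, ZMod.natCast_zmod_val]⟩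
    obtain ⟨c, hc⟩ := hΦ h
    exact Finset.mem_image.2 ⟨c, Finset.mem_univ _, hc.symm⟩
  have hcard : (Finset.univ.image Φ).card ≤ T.card := by
    rw [hTcard]
    refine Finset.card_image_le.trans ?_
    rw [Finset.card_univ, Fintype.card_fun, ZMod.card, Fintype.card_fin]
  have heq := Finset.eq_of_subset_of_card_le hsub hcard
  obtain ⟨c, hc⟩ := hΦ g
  have hmem : aeval (shiftOp (2 ^ m - 1)) g s ∈ T := by
    rw [heq, hc]
    exact Finset.mem_image_of_mem _ (Finset.mem_univ _)
  rcases Finset.mem_insert.1 hmem with h | h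
  · exact absurd h hg
  · obtain ⟨t, _, ht⟩ := Finset.mem_image.1 h
    exact ⟨t, ht.symm⟩

lemma annihilatorIdeal_isMaximal (hm : 0 < m) (hs : IsMaximumLength m s) :
    (annihilatorIdeal s).IsMaximal := by
  have hP : 1 < 2 ^ m := Nat.one_lt_two_pow hm.ne'
  have : NeZero (2 ^ m - 1) := ⟨by omega⟩
  refine Ideal.isMaximal_iff.2 ⟨fun h => hs.1 ?_, fun J g hJ hg hgJ => ?_⟩
  · rw [mem_annihilatorIdeal, map_one] at h
    exact h
  · obtain ⟨t, ht⟩ := hs.exists_shift_eq hm g hg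
    -- `g` is congruent to a power of `X`, which is a unit since `X ^ (2 ^ m - 1)` acts trivially.
    have h1 : g - X ^ t.val ∈ J := hJ <| by
      rw [mem_annihilatorIdeal, map_sub, LinearMap.sub_apply, ht, aeval_shiftOp_X_pow,
        ZMod.natCast_zmod_val, sub_self]
    have h2 : X ^ t.val * X ^ (-t).val ∈ J := by
      refine J.mul_mem_right _ ?_
      have := J.sub_mem hgJ h1
      rwa [sub_sub_cancel] at this
    have h3 : X ^ t.val * X ^ (-t).val - 1 ∈ J := hJ <| by
      rw [← pow_add, ← pow_zero X, mem_annihilatorIdeal, map_sub, LinearMap.sub_apply,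
        aeval_shiftOp_X_pow, aeval_shiftOp_X_pow, Nat.cast_add,
        ZMod.natCast_zmod_val, ZMod.natCast_zmod_val,
        add_neg_cancel, Nat.cast_zero, sub_self]
    have := J.sub_mem h2 h3
    rwa [sub_sub_cancel] at this

/-- A maximum-length sequence is of the form `i ↦ Tr (a * ω ^ i)`, where `ω` generates the
multiplicative group of the field with `2 ^ m` elements. The map `i ↦ ω ^ i` is `E` here. -/
theorem exists_trace_representation (hm : 0 < m) (hs : IsMaximumLength m s) :
    ∃ (F : Type) (_ : Field F) (_ : Fintype F) (_ : Algebra (ZMod 2) F)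
      (E : ZMod (2 ^ m - 1) → F) (a : F), Nat.card F = 2 ^ m ∧
      (∀ i j, E (i + j) = E i * E j) ∧ Function.Injective E ∧
      (∀ x, x ≠ 0 ↔ ∃ i, E i = x) ∧
      ∀ i, s i = Algebra.trace (ZMod 2) F (a * E i) := by
  classical
  have hP : 1 < 2 ^ m := Nat.one_lt_two_pow hm.ne'
  have : NeZero (2 ^ m - 1) := ⟨by omega⟩
  have := hs.annihilatorIdeal_isMaximal hm
  let I := annihilatorIdeal s
  let fieldF : Field ((ZMod 2)[X] ⧸ I) := Ideal.Quotient.field I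
  let E : ZMod (2 ^ m - 1) → (ZMod 2)[X] ⧸ I := fun i => Ideal.Quotient.mk I (X ^ i.val)
  have hEinj : Function.Injective E := by
    intro i j hij
    have h := mk_eq_mk_iff.1 hij
    rw [aeval_shiftOp_X_pow, aeval_shiftOp_X_pow, ZMod.natCast_zmod_val, ZMod.natCast_zmod_val] at h
    exact hs.shift_injective h
  have hEadd : ∀ i j, E (i + j) = E i * E j := by
    intro i j
    change _ = Ideal.Quotient.mk I (X ^ i.val) * Ideal.Quotient.mk I (X ^ j.val)
    rw [← map_mul, ← pow_add]
    refine mk_eq_mk_iff.2 ?_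
    rw [aeval_shiftOp_X_pow, aeval_shiftOp_X_pow, Nat.cast_add]
    simp only [ZMod.natCast_zmod_val]
  have hEsurj : ∀ x, x ≠ 0 ↔ ∃ i, E i = x := by
    intro x
    constructor
    · intro hx
      obtain ⟨g, rfl⟩ := Ideal.Quotient.mk_surjective x
      have hg : aeval (shiftOp (2 ^ m - 1)) g s ≠ 0 := fun h =>
        hx (Ideal.Quotient.eq_zero_iff_mem.2 h)
      obtain ⟨t, ht⟩ := hs.exists_shift_eq hm g hg
      exact ⟨t, mk_eq_mk_iff.2 (by rw [ht, aeval_shiftOp_X_pow, ZMod.natCast_zmod_val])⟩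
    · rintro ⟨i, rfl⟩ h
      have h' := mem_annihilatorIdeal.1 (Ideal.Quotient.eq_zero_iff_mem.1 h)
      rw [aeval_shiftOp_X_pow] at h'
      exact hs.shift_ne_zero _ h'
  let e : Option (ZMod (2 ^ m - 1)) → (ZMod 2)[X] ⧸ I := fun o => o.elim 0 E
  have he : Function.Bijective e := by
    constructor
    · rintro (_ | i) (_ | j) hij
      · rfl
      · exact absurd hij.symm ((hEsurj _).2 ⟨j, rfl⟩)
      · exact absurd hij ((hEsurj _).2 ⟨i, rfl⟩)
      · exact congrArg some (hEinj hij)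
    · intro x
      by_cases hx : x = 0
      · exact ⟨none, hx.symm⟩
      · obtain ⟨i, hi⟩ := (hEsurj x).1 hx
        exact ⟨some i, hi⟩
  let fin : Fintype ((ZMod 2)[X] ⧸ I) := Fintype.ofBijective e he
  have hcard : Nat.card ((ZMod 2)[X] ⧸ I) = 2 ^ m := by
    rw [← Nat.card_congr (Equiv.ofBijective e he), Nat.card_eq_fintype_card, Fintype.card_option,
      ZMod.card]
    omega
  obtain ⟨r, hr⟩ : ∃ r : (ZMod 2)[X] ⧸ I → (ZMod 2)[X], ∀ x, Ideal.Quotient.mk I (r x) = x :=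
    ⟨_, Function.surjInv_eq Ideal.Quotient.mk_surjective⟩
  let lam : ((ZMod 2)[X] ⧸ I) →ₗ[ZMod 2] ZMod 2 :=
    { toFun := fun x => aeval (shiftOp (2 ^ m - 1)) (r x) s 0
      map_add' := fun x y => by
        rw [← Pi.add_apply, ← LinearMap.add_apply, ← map_add]
        refine congrFun (mk_eq_mk_iff.1 ?_) 0
        change Ideal.Quotient.mk I _ = Ideal.Quotient.mk I _
        rw [map_add, hr, hr, hr]
      map_smul' := fun c x => by
        rw [RingHom.id_apply, ← Pi.smul_apply, ← LinearMap.smul_apply, ← map_smul]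
        refine congrFun (mk_eq_mk_iff.1 ?_) 0
        change Ideal.Quotient.mk I _ = Ideal.Quotient.mkₐ (ZMod 2) I _
        rw [map_smul, Ideal.Quotient.mkₐ_eq_mk, hr, hr] }
  have hlam : ∀ g, lam (Ideal.Quotient.mk I g) = aeval (shiftOp (2 ^ m - 1)) g s 0 := fun g =>
    congrFun (mk_eq_mk_iff.1 (hr _)) 0
  obtain ⟨a, ha⟩ := (LinearMap.BilinForm.toDual (Algebra.traceForm (ZMod 2) ((ZMod 2)[X] ⧸ I))
    (traceForm_nondegenerate _ _)).surjective lam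
  refine ⟨(ZMod 2)[X] ⧸ I, fieldF, fin, inferInstance, E, a, hcard, hEadd, hEinj, hEsurj,
    fun i => ?_⟩
  have h1 : lam (E i) = Algebra.trace (ZMod 2) ((ZMod 2)[X] ⧸ I) (a * E i) := by
    rw [← ha]
    rfl
  rw [← h1, hlam, aeval_shiftOp_X_pow, ZMod.natCast_zmod_val]
  simp [shift]

end IsMaximumLength

end BinSeq

/-! ### The quadratic forms that vanish -/

section Vanishing

variable {K F : Type*} [Field K] [Field F] [Algebra K F] {σ : Gal(F/K)} {N k : ℕ}
  [Algebra (ZMod 2) K] [Algebra (ZMod 2) F] [IsScalarTower (ZMod 2) K F]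

lemma polarMap_eq_zero_of_traceQuadratic [Finite F] (hσ : orderOf σ = finrank K F)
    (hN : finrank K F = 2 * N) (hk : k ≤ N) {β : Fin k → F} {b : F}
    (h : ∀ x, Algebra.trace (ZMod 2) F (b * x) + traceQuadratic σ N β x = 0) :
    polarMap σ N β = 0 := by
  ext y
  rw [LinearMap.zero_apply]
  refine eq_zero_of_trace_mul fun x => ?_
  have h1 := h (x + y)
  rw [traceQuadratic_add hσ hN hk, mul_add, map_add] at h1
  rw [mul_comm]
  linear_combination h1 - h x - h y

variable [FiniteDimensional K F] [IsGalois K F] [CharP F 2]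

lemma traceQuadratic_eq_zero_of_polarMap (hσ : orderOf σ = finrank K F)
    (hN : finrank K F = 2 * N) (hk : k ≤ N) {β : Fin k → F} (h : polarMap σ N β = 0) (x : F) :
    traceQuadratic σ N β x = 0 := by
  rcases Nat.eq_zero_or_pos k with rfl | hk0
  · simp [traceQuadratic]
  obtain ⟨h0, h1⟩ := (polarMap_eq_zero_iff hσ hN hk0 hk β).1 h
  rw [traceQuadratic, Finset.sum_eq_single ⟨0, hk0⟩]
  · have hx : (σ ^ N) ((σ ^ N) x) = x := by
      simpa using pow_sub_pow_add_apply hσ hN (Nat.zero_le N) x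
    have hfix : (σ ^ N) (β ⟨0, hk0⟩ * (x * (σ ^ (N - 0)) x)) =
        β ⟨0, hk0⟩ * (x * (σ ^ (N - 0)) x) := by
      rw [Nat.sub_zero, map_mul, map_mul, hx, h0]
      ring
    obtain ⟨w, hw⟩ := exists_sub_eq_of_fixed hσ hN hfix
    rw [← hw, map_sub, trace_zmod_gal_apply, sub_self]
  · intro j _ hj
    rw [h1 j fun h => hj (Fin.ext h), zero_mul, map_zero]
  · simp

end Vanishing

/-! ### Counting Walsh coefficients over the family -/

section WalshCount

variable {K F : Type*} [Field K] [Field F] [Algebra K F] [Fintype F] {σ : Gal(F/K)} {N k : ℕ}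
  [Algebra (ZMod 2) K] [Algebra (ZMod 2) F] [IsScalarTower (ZMod 2) K F]
  [FiniteDimensional K F]

/-- The pairing `(b, x) ↦ Tr (b * x)` with values in `𝔽₂`. -/
noncomputable def tracePairing (F : Type*) [Field F] [Algebra (ZMod 2) F] : F →+ F →+ ZMod 2 :=
  AddMonoidHom.mul.compr₂ (Algebra.trace (ZMod 2) F).toAddMonoidHom

open scoped Classical in
lemma card_walsh_traceQuadratic (hσ : orderOf σ = finrank K F) (hN : finrank K F = 2 * N)
    (hk : k ≤ N) (β : Fin k → F) {j : ℕ} {ε : ℤ} (hε : ε = 1 ∨ ε = -1) :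
    2 * (((Nat.card K : ℤ) ^ (N + j)) ^ 2) * ((Finset.univ.filter fun b =>
        walsh (tracePairing F) (traceQuadratic σ N β) b =
          ε * (Nat.card K : ℤ) ^ (N + j)).card : ℤ) =
      if finrank K (LinearMap.ker (polarMap σ N β)) = 2 * j then
        ((Nat.card K : ℤ) ^ (2 * N)) ^ 2 +
          ε * (Nat.card K : ℤ) ^ (N + j) * (Nat.card K : ℤ) ^ (2 * N)
      else 0 := by
  have : Finite K := Finite.of_injective _ (algebraMap K F).injective
  have hq1 : 1 < (Nat.card K : ℤ) := by exact_mod_cast Finite.one_lt_card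
  let B : F →+ F →+ ZMod 2 :=
    ((tracePairing F).flip.comp (polarMap σ N β).toAddMonoidHom).flip
  have hB : ∀ x y, traceQuadratic σ N β (x + y) =
      traceQuadratic σ N β x + traceQuadratic σ N β y + B x y :=
    traceQuadratic_add hσ hN hk β
  have hℓ : ∀ x, (∀ b, tracePairing F b x = 0) → x = 0 := fun x hx =>
    eq_zero_of_trace_mul fun b => by rw [mul_comm]; exact hx b
  have hF : (Fintype.card F : ℤ) = (Nat.card K : ℤ) ^ (2 * N) := by
    rw [← Nat.card_eq_fintype_card, Module.natCard_eq_pow_finrank (K := K), hN, Nat.cast_pow]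
  have hrad : ((Finset.univ.filter fun z => ∀ y, B y z = 0).card : ℤ) =
      (Nat.card K : ℤ) ^ finrank K (LinearMap.ker (polarMap σ N β)) := by
    rw [← Nat.cast_pow, ← Module.natCard_eq_pow_finrank, Nat.card_eq_fintype_card]
    congr 1
    refine (Fintype.card_of_subtype _ fun z => ?_).symm
    rw [Finset.mem_filter, and_iff_right (Finset.mem_univ _), LinearMap.mem_ker]
    constructor
    · exact fun h => hℓ _ h
    · intro h y
      change Algebra.trace (ZMod 2) F (y * polarMap σ N β z) = 0
      rw [h, mul_zero, map_zero]
  split_ifs with hj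
  · rw [card_walsh_eq hℓ hB (pow_pos (by omega) _) _ hε, hF]
    rw [hrad, hF, hj]
    ring
  · rw [mul_eq_zero]
    right
    rw [Nat.cast_eq_zero, Finset.card_eq_zero, Finset.filter_eq_empty_iff]
    intro b _ hb
    rcases walsh_sq_eq (ℓ := tracePairing F) hB b with h | h
    · rw [hb] at h
      have : (Nat.card K : ℤ) ^ (N + j) ≠ 0 := (pow_pos (by omega) _).ne'
      rcases hε with rfl | rfl <;> simp_all
    · rw [hrad, hF, hb, mul_pow, show ε ^ 2 = 1 by rcases hε with rfl | rfl <;> rfl, one_mul,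
        ← pow_mul, ← pow_add] at h
      have := pow_right_injective₀ (by omega) (by omega) h
      omega

variable [IsGalois K F] [CharP F 2]

open scoped Classical in
/-- The distribution of the Walsh coefficients over all members of the family. -/
lemma card_walsh_family (hσ : orderOf σ = finrank K F) (hN : finrank K F = 2 * N)
    (hk : k ≤ N) {q : ℚ} (hq : q = Nat.card K) {j : ℕ} (hj : j < k) {ε : ℤ}
    (hε : ε = 1 ∨ ε = -1) :
    ((Finset.univ.filter fun p : F × (Fin k → F) =>
      walsh (tracePairing F) (traceQuadratic σ N p.2) p.1 =
        ε * (Nat.card K : ℤ) ^ (N + j)).card : ℚ) =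
      q ^ N * ((1 / 2 : ℚ) * (q ^ (2 * N - 2 * j) + ε * q ^ (N - j)) *
      ∑ v ∈ Finset.Icc j (k - 1), (-1 : ℚ) ^ (v - j) * (q ^ 2) ^ ((v - j).choose 2) *
        gaussianBinomial (q ^ 2) v j * gaussianBinomial (q ^ 2) N v *
        (q ^ (N * (2 * k - 1 - 2 * v) + v) - 1)) := by
  have : Finite K := Finite.of_injective _ (algebraMap K F).injective
  have hq0 : q ≠ 0 := by
    rw [hq]
    exact_mod_cast Nat.card_pos.ne'
  have h1 : (Finset.univ.filter fun p : F × (Fin k → F) =>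
      walsh (tracePairing F) (traceQuadratic σ N p.2) p.1 = ε * (Nat.card K : ℤ) ^ (N + j)).card =
      ∑ β : Fin k → F, (Finset.univ.filter fun b =>
        walsh (tracePairing F) (traceQuadratic σ N β) b = ε * (Nat.card K : ℤ) ^ (N + j)).card := by
    simp only [Finset.card_filter]
    exact Fintype.sum_prod_type_right _
  have h2 : 2 * (((Nat.card K : ℤ) ^ (N + j)) ^ 2) * ((Finset.univ.filter
      fun p : F × (Fin k → F) => walsh (tracePairing F) (traceQuadratic σ N p.2) p.1 =
        ε * (Nat.card K : ℤ) ^ (N + j)).card : ℤ) =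
      ((Finset.univ.filter fun β : Fin k → F =>
        finrank K (LinearMap.ker (polarMap σ N β)) = 2 * j).card : ℤ) *
        (((Nat.card K : ℤ) ^ (2 * N)) ^ 2 +
          ε * (Nat.card K : ℤ) ^ (N + j) * (Nat.card K : ℤ) ^ (2 * N)) := by
    rw [h1, Nat.cast_sum, Finset.mul_sum]
    simp only [card_walsh_traceQuadratic hσ hN hk _ hε]
    rw [← Finset.sum_filter, Finset.sum_const, nsmul_eq_mul]
  have h3 := congrArg (Int.cast : ℤ → ℚ) h2
  push_cast at h3
  rw [card_finrank_ker_eq hσ hN hk hq hj, ← hq] at h3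
  have h4 : 2 * (q ^ (N + j)) ^ 2 ≠ 0 := by positivity
  refine mul_left_cancel₀ h4 (h3.trans ?_)
  obtain ⟨w, rfl⟩ : ∃ w, N = j + w := ⟨N - j, by omega⟩
  rw [show 2 * (j + w) - 2 * j = 2 * w by omega, Nat.add_sub_cancel_left]
  ring

end WalshCount

/-! ### The code as the image of the coefficient vectors -/

section Code

lemma apply_natCast_mul {F : Type*} [Field F] {M : ℕ} {E : ZMod M → F}
    (hE : ∀ i j, E (i + j) = E i * E j) (hE0 : E 0 ≠ 0)
    (f : ℕ) (i : ZMod M) : E ((f : ZMod M) * i) = E i ^ f := by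
  induction f with
  | zero =>
    have h := hE 0 0
    rw [add_zero] at h
    simpa using (mul_eq_left₀ hE0).1 h.symm
  | succ f ih => rw [Nat.cast_succ, add_mul, one_mul, hE, ih, pow_succ]

variable {K F : Type*} [Field K] [Field F] [Algebra K F] [Algebra (ZMod 2) F] {M : ℕ}

/-- The word with entries `Tr (b * x) + ∑ j, Tr (β j * (x * σ ^ (N - j) x))` at the points
`x = E i`. -/
noncomputable def kasamiWord (σ : Gal(F/K)) (N k : ℕ) (E : ZMod M → F) :
    F × (Fin k → F) →ₗ[ZMod 2] BinSeq M :=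
  AddMonoidHom.toZModLinearMap 2 <| AddMonoidHom.mk'
    (fun p i => Algebra.trace (ZMod 2) F (p.1 * E i) + traceQuadratic σ N p.2 (E i))
    (fun p p' => by
      funext i
      simp only [Prod.fst_add, Prod.snd_add, Pi.add_apply, traceQuadratic, add_mul, map_add,
        Finset.sum_add_distrib]
      ring)

variable {σ : Gal(F/K)} {N k : ℕ} {E : ZMod M → F}

lemma kasamiWord_apply (p : F × (Fin k → F)) (i : ZMod M) :
    kasamiWord σ N k E p i =
      Algebra.trace (ZMod 2) F (p.1 * E i) + traceQuadratic σ N p.2 (E i) := rfl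

lemma BinSeq.dc_eq_sum [NeZero M] (c : BinSeq M) : BinSeq.dc c = ∑ i, binarySign (c i) := by
  rw [BinSeq.dc]
  refine Finset.sum_nbij' (fun i => (i : ZMod M)) ZMod.val (fun _ _ => Finset.mem_univ _)
    (fun i _ => Finset.mem_range.2 (ZMod.val_lt i))
    (fun i hi => ZMod.val_cast_of_lt (Finset.mem_range.1 hi))
    (fun i _ => ZMod.natCast_zmod_val i) fun _ _ => rfl

/-- The DC component lacks the contribution `1` of the point `0` to the Walsh coefficient. -/
lemma dc_kasamiWord [Fintype F] [NeZero M] (hE : Function.Injective E)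
    (hE' : ∀ x, x ≠ 0 ↔ ∃ i, E i = x) (p : F × (Fin k → F)) :
    BinSeq.dc (kasamiWord σ N k E p) =
      -1 + walsh (tracePairing F) (traceQuadratic σ N p.2) p.1 := by
  classical
  rw [BinSeq.dc_eq_sum, walsh, ← Finset.add_sum_erase _ _ (Finset.mem_univ (0 : F))]
  have h0 : binarySign (tracePairing F p.1 0 + traceQuadratic σ N p.2 0) = 1 := by
    simp [traceQuadratic]
  rw [h0, neg_add_cancel_left]
  refine Finset.sum_bij (fun i _ => E i)
    (fun i _ => Finset.mem_erase.2 ⟨(hE' _).2 ⟨i, rfl⟩, Finset.mem_univ _⟩)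
    (fun i _ j _ h => hE h) (fun x hx => ?_) (fun i _ => rfl)
  obtain ⟨i, hi⟩ := (hE' x).1 (Finset.mem_erase.1 hx).1
  exact ⟨i, Finset.mem_univ _, hi⟩

variable [Algebra (ZMod 2) K] [IsScalarTower (ZMod 2) K F] [FiniteDimensional K F] [IsGalois K F]
  [CharP F 2]

lemma kasamiWord_eq_zero_iff [Finite F] (hσ : orderOf σ = finrank K F)
    (hN : finrank K F = 2 * N) (hk : k ≤ N) (hE' : ∀ x, x ≠ 0 ↔ ∃ i, E i = x)
    (p : F × (Fin k → F)) :
    kasamiWord σ N k E p = 0 ↔ p.1 = 0 ∧ polarMap σ N p.2 = 0 := by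
  constructor
  · intro h
    have hall : ∀ x, Algebra.trace (ZMod 2) F (p.1 * x) + traceQuadratic σ N p.2 x = 0 := by
      intro x
      by_cases hx : x = 0
      · simp [hx, traceQuadratic]
      · obtain ⟨i, rfl⟩ := (hE' x).1 hx
        exact congrFun h i
    have hL := polarMap_eq_zero_of_traceQuadratic hσ hN hk hall
    refine ⟨eq_zero_of_trace_mul fun x => ?_, hL⟩
    have := hall x
    rwa [traceQuadratic_eq_zero_of_polarMap hσ hN hk hL, add_zero] at this
  · rintro ⟨h1, h2⟩
    funext i
    rw [kasamiWord_apply, h1, traceQuadratic_eq_zero_of_polarMap hσ hN hk h2]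
    simp

lemma card_kasamiWord_eq_zero [Finite F] (hσ : orderOf σ = finrank K F)
    (hN : finrank K F = 2 * N) (hk0 : 0 < k) (hk : k ≤ N) (hE' : ∀ x, x ≠ 0 ↔ ∃ i, E i = x) :
    Nat.card {p : F × (Fin k → F) // kasamiWord σ N k E p = 0} = Nat.card K ^ N := by
  rw [← card_polarMap_eq_zero hσ hN hk0 hk]
  exact Nat.card_congr
    { toFun := fun p => ⟨p.1.2, ((kasamiWord_eq_zero_iff hσ hN hk hE' p.1).1 p.2).2⟩
      invFun := fun β => ⟨(0, β.1), (kasamiWord_eq_zero_iff hσ hN hk hE' _).2 ⟨rfl, β.2⟩⟩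
      left_inv := fun p => Subtype.ext (Prod.ext
        ((kasamiWord_eq_zero_iff hσ hN hk hE' p.1).1 p.2).1.symm rfl)
      right_inv := fun β => rfl }

/-- The code consists of all words of coefficient vectors. That the shifts of the decimations
suffice is seen by duality: a functional `Tr (z * _)` that vanishes on the reachable coefficients
of a decimation yields a quadratic form `x ↦ Tr (z * a * (x * σ ^ (N - j) x))` that vanishes
identically, which for `j = 0` leads to `s₀ = 0` and for `j > 0` to `z = 0`. -/
lemma kasamiCode_eq_range [Finite F] {n d e : ℕ} (hσ : orderOf σ = finrank K F)
    (hN : finrank K F = 2 * N) (hk0 : 0 < k) (hk : k ≤ N) (hNe : n / e = N)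
    (hσd : ∀ (l : ℕ) (x : F), (σ ^ l) x = x ^ 2 ^ (l * d))
    (hE : ∀ i j, E (i + j) = E i * E j) (hE' : ∀ x, x ≠ 0 ↔ ∃ i, E i = x)
    {s : BinSeq M} {a : F} (ha : a ≠ 0) (hs : ∀ i, s i = Algebra.trace (ZMod 2) F (a * E i))
    (hs₀ : BinSeq.kasamiDecimation n d e s 0 ≠ 0) :
    BinSeq.kasamiCode n d e k s = LinearMap.range (kasamiWord σ N k E) := by
  have hE0 : E 0 ≠ 0 := (hE' _).2 ⟨0, rfl⟩
  have hdec : ∀ (j : ℕ) (i : ZMod M), BinSeq.kasamiDecimation n d e s j i =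
      Algebra.trace (ZMod 2) F (a * (E i * (σ ^ (N - j)) (E i))) := by
    intro j i
    rw [BinSeq.kasamiDecimation, BinSeq.decimate, hs, apply_natCast_mul hE hE0, hσd, hNe, pow_succ']
  have hshift : ∀ t : ZMod M, BinSeq.shift t s = kasamiWord σ N k E (a * E t, 0) := by
    intro t
    funext i
    rw [kasamiWord_apply, BinSeq.shift, hs, hE]
    simp only [traceQuadratic, Pi.zero_apply, zero_mul, map_zero, Finset.sum_const_zero, add_zero]
    congr 1
    ring
  have hshift' : ∀ (t : ZMod M) (j : Fin k),
      BinSeq.shift t (BinSeq.kasamiDecimation n d e s j) =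
        kasamiWord σ N k E (0, Pi.single j (a * (E t * (σ ^ (N - j : ℕ)) (E t)))) := by
    intro t j
    funext i
    rw [kasamiWord_apply, BinSeq.shift, hdec, hE, traceQuadratic_single, zero_mul, map_zero,
      zero_add, map_mul (σ ^ (N - j : ℕ))]
    congr 1
    ring
  set C := BinSeq.kasamiCode n d e k s with hC
  have hmem : ∀ t : ZMod M, kasamiWord σ N k E (a * E t, 0) ∈ C := fun t =>
    Submodule.subset_span ⟨t, Or.inl (hshift t).symm⟩
  have hmem' : ∀ (t : ZMod M) (j : Fin k),
      kasamiWord σ N k E (0, Pi.single j (a * (E t * (σ ^ (N - j : ℕ)) (E t)))) ∈ C :=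
    fun t j => Submodule.subset_span ⟨t, Or.inr ⟨j, j.2, (hshift' t j).symm⟩⟩
  refine le_antisymm (Submodule.span_le.2 ?_) ?_
  · rintro _ ⟨t, rfl | ⟨j, hj, rfl⟩⟩
    · exact ⟨_, (hshift t).symm⟩
    · exact ⟨_, (hshift' t ⟨j, hj⟩).symm⟩
  · have hlin : ∀ b, kasamiWord σ N k E (b, 0) ∈ C := by
      intro b
      by_cases hb : b = 0
      · rw [hb, Prod.mk_zero_zero, map_zero]
        exact C.zero_mem
      · obtain ⟨t, ht⟩ := (hE' (a⁻¹ * b)).1 (mul_ne_zero (inv_ne_zero ha) hb)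
        have := hmem t
        rwa [ht, mul_inv_cancel_left₀ ha] at this
    have hquad : ∀ (j : Fin k) (c : F), kasamiWord σ N k E (0, Pi.single j c) ∈ C := by
      intro j
      let V : Submodule (ZMod 2) F := C.comap (kasamiWord σ N k E ∘ₗ
        LinearMap.inr (ZMod 2) F (Fin k → F) ∘ₗ LinearMap.single (ZMod 2) (fun _ => F) j)
      suffices hV : V = ⊤ from fun c => (hV ▸ Submodule.mem_top : c ∈ V)
      by_contra hne
      obtain ⟨f, hf0, hf⟩ := Submodule.exists_le_ker_of_lt_top _ (lt_top_iff_ne_top.2 hne)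
      obtain ⟨z, hz⟩ := (LinearMap.BilinForm.toDual (Algebra.traceForm (ZMod 2) F)
        (traceForm_nondegenerate _ _)).surjective f
      have hfz : ∀ c, f c = Algebra.trace (ZMod 2) F (z * c) := fun c => by rw [← hz]; rfl
      have hz0 : z ≠ 0 := by
        rintro rfl
        exact hf0 (LinearMap.ext fun c => by rw [hfz, zero_mul, map_zero]; rfl)
      have hzV : ∀ c, kasamiWord σ N k E (0, Pi.single j c) ∈ C →
          Algebra.trace (ZMod 2) F (z * c) = 0 := by
        intro c hc
        rw [← hfz]
        exact hf hc
      have hpolar : polarMap σ N (Pi.single j (z * a)) = 0 := by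
        refine ((kasamiWord_eq_zero_iff (E := E) hσ hN hk hE' (0, Pi.single j (z * a))).1 ?_).2
        funext t
        rw [kasamiWord_apply, traceQuadratic_single, zero_mul, map_zero, zero_add, mul_assoc]
        exact hzV _ (hmem' t j)
      have hiff := polarMap_eq_zero_iff hσ hN hk0 hk
      obtain ⟨h0, h1⟩ := (hiff _).1 hpolar
      by_cases hj : (j : ℕ) = 0
      · obtain rfl : j = ⟨0, hk0⟩ := Fin.ext hj
        rw [Pi.single_eq_same] at h0
        have hsq : ∀ y, (σ ^ N) ((σ ^ N) y) = y := fun y => by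
          simpa using pow_sub_pow_add_apply hσ hN (Nat.zero_le N) y
        -- The coefficients fixed by the involution contribute nothing, so `z` is fixed as well.
        have hsingle : ∀ c, (σ ^ N) c = c →
            polarMap σ N (Pi.single ⟨0, hk0⟩ c : Fin k → F) = 0 := by
          intro c hc
          refine (hiff _).2 ⟨by rw [Pi.single_eq_same, hc], fun i hi => ?_⟩
          exact Pi.single_eq_of_ne (fun h => hi (by rw [h])) _
        have hword : ∀ c, (σ ^ N) c = c →
            kasamiWord σ N k E (0, Pi.single ⟨0, hk0⟩ c) = 0 := fun c hc =>
          (kasamiWord_eq_zero_iff hσ hN hk hE' (0, Pi.single ⟨0, hk0⟩ c)).2 ⟨rfl, hsingle c hc⟩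
        have hzfix : (σ ^ N) z = z := by
          rw [← sub_eq_zero]
          refine eq_zero_of_trace_mul fun y => ?_
          have hfix : (σ ^ N) ((σ ^ N) y + y) = (σ ^ N) y + y := by
            rw [map_add, hsq, add_comm]
          have h2 := hzV ((σ ^ N) y + y) (by rw [hword _ hfix]; exact C.zero_mem)
          rw [mul_add, map_add, ← trace_zmod_gal_apply (σ := σ) N (z * (σ ^ N) y),
            map_mul (σ ^ N), hsq, ← map_add, ← add_mul] at h2
          rwa [CharTwo.sub_eq_add]
        have hafix : (σ ^ N) a = a := by
          rw [map_mul (σ ^ N), hzfix] at h0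
          exact mul_left_cancel₀ hz0 h0
        refine hs₀ (funext fun i => ?_)
        have h3 := traceQuadratic_eq_zero_of_polarMap hσ hN hk (hsingle a hafix) (E i)
        rw [traceQuadratic_single] at h3
        rw [hdec]
        exact h3
      · have h2 := h1 j hj
        rw [Pi.single_eq_same] at h2
        exact mul_ne_zero hz0 ha h2
    rintro _ ⟨⟨b, β⟩, rfl⟩
    have hsplit : ((b, β) : F × (Fin k → F)) = (b, 0) + ∑ j, (0, Pi.single j (β j)) := by
      refine Prod.ext ?_ ?_
      · simp [Prod.fst_sum]
      · simp [Prod.snd_sum, Finset.univ_sum_single]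
    rw [hsplit, map_add, map_sum]
    exact C.add_mem (hlin b) (C.sum_mem fun j _ => hquad j (β j))

end Code

/-! ### The weight distribution of the code -/

/-- The number of preimages of the elements with a given property, in terms of the kernel. -/
lemma card_filter_comp_eq {X Y : Type*} [AddCommGroup X] [Fintype X] [AddCommGroup Y]
    (f : X →+ Y) (P : Y → Prop) [DecidablePred P] :
    (Finset.univ.filter fun x => P (f x)).card =
      Nat.card {x // f x = 0} * {y | y ∈ Set.range f ∧ P y}.ncard := by
  classical
  have himage : {y | y ∈ Set.range f ∧ P y} =
      ((Finset.univ.filter fun x => P (f x)).image f : Finset Y) := by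
    ext y
    simp only [Set.mem_ofPred_eq, Set.mem_range, Finset.coe_image, Finset.coe_filter,
      Finset.mem_univ, true_and, Set.mem_image]
    constructor
    · rintro ⟨⟨x, rfl⟩, h⟩
      exact ⟨x, h, rfl⟩
    · rintro ⟨x, h, rfl⟩
      exact ⟨⟨x, rfl⟩, h⟩
  rw [himage, Set.ncard_coe_finset, mul_comm, Nat.card_eq_fintype_card, Fintype.card_subtype]
  rw [Finset.card_eq_sum_card_image f, Finset.sum_const_nat]
  intro y hy
  obtain ⟨x, hx, rfl⟩ := Finset.mem_image.1 hy
  rw [← AddMonoidHom.card_fiber_eq_of_mem_range f ⟨x, rfl⟩ ⟨0, map_zero f⟩, Finset.filter_filter]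
  congr 1
  ext x'
  rw [Finset.mem_filter, Finset.mem_filter, and_iff_right (Finset.mem_univ _),
    and_iff_right (Finset.mem_univ _), and_iff_right_iff_imp]
  intro h
  rw [h]
  exact (Finset.mem_filter.1 hx).2

/-- The `d`-th power of the Frobenius generates the Galois group over its fixed field, which has
`2 ^ e` elements. -/
lemma exists_galois_power {F : Type*} [Field F] [Fintype F] [Algebra (ZMod 2) F] {m n d e : ℕ}
    (hn : 0 < n) (hm : m = 2 * n) (he : e = Nat.gcd n d) (he' : e = Nat.gcd m d)
    (hF : Nat.card F = 2 ^ m) :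
    ∃ (K : IntermediateField (ZMod 2) F) (σ : Gal(F/K)),
      (∀ (l : ℕ) (x : F), (σ ^ l) x = x ^ 2 ^ (l * d)) ∧ orderOf σ = finrank K F ∧
      finrank K F = 2 * (n / e) ∧ Nat.card K = 2 ^ e := by
  have he0 : 0 < e := he ▸ Nat.gcd_pos_of_pos_left d hn
  obtain ⟨N, hN⟩ : e ∣ n := he ▸ Nat.gcd_dvd_left n d
  have hfin : finrank (ZMod 2) F = m := by
    have h := Module.natCard_eq_pow_finrank (K := ZMod 2) (V := F)
    rw [hF, Nat.card_zmod] at h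
    exact (Nat.pow_right_injective le_rfl h).symm
  let φ : Gal(F/ZMod 2) := FiniteField.frobeniusAlgEquivOfAlgebraic (ZMod 2) F ^ d
  have hφ : orderOf φ = 2 * N := by
    rw [orderOf_pow, FiniteField.orderOf_frobeniusAlgEquivOfAlgebraic, hfin, ← he', hm, hN,
      show 2 * (e * N) = e * (2 * N) by ring, Nat.mul_div_cancel_left _ he0]
  have hφx : ∀ x, φ x = x ^ 2 ^ d := by
    intro x
    have h := congrFun (FiniteField.coe_frobeniusAlgEquivOfAlgebraic_iterate (ZMod 2) F d) x
    rw [ZMod.card] at h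
    rw [← h, ← AlgEquiv.coe_pow]
  let H := Subgroup.zpowers φ
  let σ : Gal(F/IntermediateField.fixedField H) :=
    IntermediateField.subgroupEquivAlgEquiv H ⟨φ, Subgroup.mem_zpowers φ⟩
  have hσφ : ∀ x, σ x = φ x := fun x => rfl
  have hrank : finrank (IntermediateField.fixedField H) F = 2 * N := by
    rw [IntermediateField.finrank_fixedField_eq_card, Nat.card_zpowers, hφ]
  refine ⟨IntermediateField.fixedField H, σ, fun l x => ?_, ?_, ?_, ?_⟩
  · induction l with
    | zero => simp
    | succ l ih =>
      rw [pow_succ', AlgEquiv.mul_apply, ih, hσφ, hφx, ← pow_mul, ← pow_add]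
      congr 2
      ring
  · rw [hrank, ← hφ, MulEquiv.orderOf_eq, Subgroup.orderOf_mk]
  · rw [hrank, hN, Nat.mul_div_cancel_left _ he0]
  · have h := Module.natCard_eq_pow_finrank (K := IntermediateField.fixedField H) (V := F)
    have hN0 : N ≠ 0 := by
      rintro rfl
      omega
    rw [hF, hrank, hm, hN, show 2 * (e * N) = e * (2 * N) by ring, pow_mul] at h
    exact (Nat.pow_left_injective (by omega : 2 * N ≠ 0) h).symm

theorem theorem1p2 (m n d e k : ℕ) (hn : 0 < n) (hd : 0 < d) (hm : m = 2 * n)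
    (he : e = Nat.gcd n d) (he' : e = Nat.gcd m d) (hk : 1 ≤ k) (hkn : k ≤ n / e)
    (s : BinSeq (2 ^ m - 1)) (hs : BinSeq.IsMaximumLength m s)
    (hs₀ : BinSeq.kasamiDecimation n d e s 0 ≠ 0)
    (j : ℕ) (hj : j < k) (ε : ℤ) (hε : ε = 1 ∨ ε = -1) :
    (({c : BinSeq (2 ^ m - 1) | c ∈ BinSeq.kasamiCode n d e k s ∧ c ≠ 0 ∧
        BinSeq.dc c = -1 + ε * 2 ^ (n + e * j)}.ncard : ℕ) : ℚ) =
      (1 / 2 : ℚ) * ((2 : ℚ) ^ (m - 2 * e * j) + (ε : ℚ) * (2 : ℚ) ^ (n - e * j)) *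
        ∑ v ∈ Finset.Icc j (k - 1),
          (-1 : ℚ) ^ (v - j) * (4 : ℚ) ^ (e * (v - j).choose 2) *
            gaussianBinomial ((4 : ℚ) ^ e) v j * gaussianBinomial ((4 : ℚ) ^ e) (n / e) v *
            ((2 : ℚ) ^ (n * (2 * k - 1 - 2 * v) + e * v) - 1) := by
  classical
  have hm0 : 0 < m := by omega
  have hP : 1 < 2 ^ m := Nat.one_lt_two_pow hm0.ne'
  have : NeZero (2 ^ m - 1) := ⟨by omega⟩
  obtain ⟨F, _, _, _, E, a, hF, hE, hEinj, hE', hsE⟩ := hs.exists_trace_representation hm0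
  obtain ⟨K, σ, hσd, hσ, hN, hK⟩ := exists_galois_power hn hm he he' hF
  have : CharP F 2 := charP_of_injective_algebraMap (algebraMap (ZMod 2) F).injective 2
  have ha : a ≠ 0 := by
    rintro rfl
    exact hs.1 (funext fun i => by rw [hsE, zero_mul, map_zero]; rfl)
  set N := n / e with hNe
  have hnN : n = e * N := (Nat.mul_div_cancel' (he ▸ Nat.gcd_dvd_left n d)).symm
  have hcode := kasamiCode_eq_range hσ hN hk hkn hNe.symm hσd hE hE' ha hsE hs₀
  have hker := card_kasamiWord_eq_zero (k := k) (E := E) hσ hN hk hkn hE'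
  have hq : (2 : ℚ) ^ e = Nat.card K := by rw [hK]; push_cast; rfl
  have hcount := card_walsh_family hσ hN hkn hq hj hε
  have hexp : (Nat.card K : ℤ) ^ (N + j) = 2 ^ (n + e * j) := by
    rw [hK, hnN, ← mul_add, pow_mul]
    push_cast
    rfl
  have hlt : n + e * j < m := by
    have : e * j < e * N := Nat.mul_lt_mul_of_pos_left (by omega) (by
      rw [he]
      exact Nat.gcd_pos_of_pos_left d hn)
    omega
  -- The zero word has DC component `2 ^ m - 1`, so the condition `c ≠ 0` is redundant.
  have hset : {c : BinSeq (2 ^ m - 1) | c ∈ BinSeq.kasamiCode n d e k s ∧ c ≠ 0 ∧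
      BinSeq.dc c = -1 + ε * 2 ^ (n + e * j)} =
      {c | c ∈ Set.range (kasamiWord σ N k E).toAddMonoidHom ∧
        BinSeq.dc c = -1 + ε * 2 ^ (n + e * j)} := by
    ext c
    rw [Set.mem_ofPred_eq, Set.mem_ofPred_eq, hcode]
    refine and_congr Iff.rfl (and_iff_right_of_imp ?_)
    rintro hc rfl
    have h0 : BinSeq.dc (0 : BinSeq (2 ^ m - 1)) = 2 ^ m - 1 := by
      rw [BinSeq.dc_eq_sum]
      simp only [Pi.zero_apply, binarySign.zero, Finset.sum_const, Finset.card_univ, ZMod.card,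
        nsmul_eq_mul, mul_one]
      rw [Nat.cast_sub hP.le]
      push_cast
      rfl
    have hpow : (2 : ℤ) ^ (n + e * j) < 2 ^ m := pow_lt_pow_right₀ (by norm_num) hlt
    have hpos : (0 : ℤ) < 2 ^ (n + e * j) := by positivity
    rw [h0] at hc
    rcases hε with rfl | rfl <;> linarith
  have hfiber := card_filter_comp_eq (kasamiWord σ N k E).toAddMonoidHom
    fun c => BinSeq.dc c = -1 + ε * 2 ^ (n + e * j)
  have hfilter : (Finset.univ.filter fun p : F × (Fin k → F) =>
      BinSeq.dc ((kasamiWord σ N k E).toAddMonoidHom p) = -1 + ε * 2 ^ (n + e * j)) =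
      Finset.univ.filter fun p : F × (Fin k → F) =>
        walsh (tracePairing F) (traceQuadratic σ N p.2) p.1 = ε * (Nat.card K : ℤ) ^ (N + j) := by
    ext p
    rw [Finset.mem_filter, Finset.mem_filter, hexp]
    refine and_congr Iff.rfl ?_
    rw [LinearMap.toAddMonoidHom_coe, dc_kasamiWord hEinj hE', add_right_inj]
  have hker' : Nat.card {p // (kasamiWord σ N k E).toAddMonoidHom p = 0} = 2 ^ (e * N) := by
    rw [pow_mul, ← hK, ← hker]
    rfl
  rw [hfilter, hker', ← hset] at hfiber
  rw [hfiber, Nat.cast_mul, ← pow_mul] at hcount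
  push_cast at hcount
  have h2 : (2 : ℚ) ^ (e * N) ≠ 0 := by positivity
  refine (mul_left_cancel₀ h2 hcount).trans ?_
  have h4 : ((2 : ℚ) ^ e) ^ 2 = 4 ^ e := by
    rw [← pow_mul, mul_comm, pow_mul]
    norm_num
  rw [h4, ← pow_mul, ← pow_mul, Nat.mul_sub, Nat.mul_sub, ← hnN, hm,
    show e * (2 * N) = 2 * n by rw [hnN]; ring, show e * (2 * j) = 2 * e * j by ring]
  congr 1
  refine Finset.sum_congr rfl fun v _ => ?_
  rw [← pow_mul, ← pow_mul, mul_add, ← mul_assoc, ← hnN]
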